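/- Let $\Bbbk$ be an algebraically closed field of characteristic $0$. Paths in a quiver are composed from left to right. A finite-dimensional $\Bbbk$-algebra $A$ is *gentle* if $A\cong \Bbbk Q/I$, where $Q$ is a finite quiver with at most two arrows starting and at most two arrows ending at each vertex, $I$ is a two-sided ideal generated by paths of length two, and for every arrow $a$, among the arrows $b$ starting where $a$ ends there is at most one with $ab\in I$ and at most one with $ab\notin I$, and among the arrows $c$ ending where $a$ starts there is at most one with $ca\in I$ and at most one with $ca\notin I$. A *maximal path* of $A$ is a path $p$ of $Q$ with $p\notin I$ such that $pa\in I$ and $ap\in I$ for every arrow $a$. Let $n\ge 1$, let $\zeta=(1\,2\,\cdots\,n)\in\mathfrak S_n$, and let $\alpha\in\mathfrak S_n$ be a *quasi-diagram*, i.e. $\alpha^2=\mathrm{id}$. A point $i$ with $\alpha(i)=i$ is called *isolated*. Suppose that $\alpha$ is *regular*, i.e. every orbit of $\zeta\alpha$ (products of permutations are composed from right to left) contains $1$ or an isolated point. Let $A\cong\Bbbk Q/I$ be the gentle algebra associated to $\alpha$, i.e. $A$ is gentle with exactly one maximal path, this path has $n$ vertices $v_1,\dots,v_n$ (listed in order,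 with repetitions), and $v_i=v_j$ if and only if $j\in\{i,\alpha(i)\}$. Put $g_n=0$, and for $j\in\{1,\dots,n\}\setminus\{n\}$ let $g_j$ be the smallest positive integer $g$ such that $(\alpha\zeta)^{g}(j)$ is equal to $n$ or is an isolated point. Put $d_{\alpha(n)}=0$, and for $i\in\{1,\dots,n\}\setminus\{\alpha(n)\}$ let $d_i$ be the smallest positive integer $d$ such that $(\zeta\alpha)^{d}(i)$ is equal to $\alpha(n)$ or is an isolated point. Then $$\operatorname{gldim} A=\max\{g_j \mid j \text{ is isolated or } j=\alpha(1)\}=\max\{d_i\mid i\text{ is isolated or } i=1\}.$$ -/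

import Mathlib

universe u v w

/-! ### Path algebras of quivers -/

/-- The paths of a quiver, including the trivial path `⟨x, x, nil⟩` at every vertex `x`. -/
abbrev QuiverPath (V : Type v) [Quiver.{w} V] : Type (max v w) :=
  Σ a b : V, Quiver.Path a b

/-- The path algebra `k Q` of a quiver with vertex set `V`: the vector space with basis the set of
all paths, multiplied by concatenation of paths, which are composed from left to right. -/
def PathAlgebra (k : Type u) (V : Type v) [Field k] [Quiver.{w} V] :
    Type (max u v w) :=
  QuiverPath V →₀ k

namespace PathAlgebra

section Module

variable {k : Type u} {V : Type v} [Field k] [Quiver.{w} V]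

noncomputable instance : AddCommGroup (PathAlgebra k V) :=
  inferInstanceAs (AddCommGroup (QuiverPath V →₀ k))

noncomputable instance : Module k (PathAlgebra k V) :=
  inferInstanceAs (Module k (QuiverPath V →₀ k))

variable (k) in
/-- A path, as a basis element of the path algebra. -/
noncomputable def ofPath (p : QuiverPath V) : PathAlgebra k V :=
  (Finsupp.single p (1 : k) : QuiverPath V →₀ k)

variable (k V) in
/-- The basis of the path algebra consisting of the paths. -/
noncomputable def basis : Module.Basis (QuiverPath V) k (PathAlgebra k V) :=
  Module.Basis.ofRepr (LinearEquiv.refl k (QuiverPath V →₀ k))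

theorem basis_apply (p : QuiverPath V) : basis k V p = ofPath k p := rfl

theorem induction {P : PathAlgebra k V → Prop} (x : PathAlgebra k V) (zero : P 0)
    (add : ∀ x y, P x → P y → P (x + y)) (smul : ∀ (a : k) x, P x → P (a • x))
    (path : ∀ p, P (ofPath k p)) : P x := by
  have hx : x ∈ Submodule.span k (Set.range (basis k V)) := by
    rw [(basis k V).span_eq]; trivial
  induction hx using Submodule.span_induction with
  | mem x h => obtain ⟨p, rfl⟩ := h; exact path p
  | zero => exact zero
  | add x y _ _ hx hy => exact add x y hx hy
  | smul a x _ hx => exact smul a x hx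

/-- The unit of the path algebra of a quiver with finitely many vertices: the sum of the trivial
paths. -/
noncomputable instance [Fintype V] : One (PathAlgebra k V) :=
  ⟨∑ x : V, ofPath k ⟨x, x, Quiver.Path.nil⟩⟩

theorem one_def [Fintype V] :
    (1 : PathAlgebra k V) = ∑ x : V, ofPath k ⟨x, x, Quiver.Path.nil⟩ := rfl

end Module

section Ring

variable {k : Type u} {V : Type v} [Field k] [Quiver.{w} V] [DecidableEq V]

variable (k) in
/-- The product of two paths: their concatenation (first `p`, then `q`) if `q` starts where `p`
ends, and zero otherwise. -/
noncomputable def mulPath (p q : QuiverPath V) : PathAlgebra k V :=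
  if h : q.1 = p.2.1 then ofPath k ⟨p.1, q.2.1, p.2.2.comp (q.2.2.cast h rfl)⟩ else 0

theorem mulPath_of_eq {a b c : V} (p : Quiver.Path a b) (q : Quiver.Path b c) :
    mulPath k (⟨a, b, p⟩ : QuiverPath V) ⟨b, c, q⟩ = ofPath k ⟨a, c, p.comp q⟩ := by
  simp [mulPath]

theorem mulPath_of_ne {p q : QuiverPath V} (h : q.1 ≠ p.2.1) : mulPath k p q = 0 := by
  simp [mulPath, h]

variable (k V) in
/-- The multiplication of the path algebra: the bilinear extension of the product of paths. -/
noncomputable def mulHom : PathAlgebra k V →ₗ[k] PathAlgebra k V →ₗ[k] PathAlgebra k V :=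
  (basis k V).constr k fun p => (basis k V).constr k fun q => mulPath k p q

noncomputable instance : Mul (PathAlgebra k V) := ⟨fun x y => mulHom k V x y⟩

theorem mul_def (x y : PathAlgebra k V) : x * y = mulHom k V x y := rfl

theorem ofPath_mul_ofPath (p q : QuiverPath V) : ofPath k p * ofPath k q = mulPath k p q := by
  simp only [mul_def, mulHom, ← basis_apply, Module.Basis.constr_basis]

protected theorem add_mul (x y z : PathAlgebra k V) : (x + y) * z = x * z + y * z := by
  simp [mul_def]

protected theorem mul_add (x y z : PathAlgebra k V) : x * (y + z) = x * y + x * z := by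
  simp [mul_def]

protected theorem zero_mul (x : PathAlgebra k V) : 0 * x = 0 := by simp [mul_def]

protected theorem mul_zero (x : PathAlgebra k V) : x * 0 = 0 := by simp [mul_def]

protected theorem smul_mul (a : k) (x y : PathAlgebra k V) : (a • x) * y = a • (x * y) := by
  simp [mul_def]

protected theorem mul_smul (a : k) (x y : PathAlgebra k V) : x * (a • y) = a • (x * y) := by
  simp [mul_def]

protected theorem mul_assoc (x y z : PathAlgebra k V) : x * y * z = x * (y * z) := by
  induction x using induction with
  | zero => simp only [PathAlgebra.zero_mul]
  | add x x' h h' => simp only [PathAlgebra.add_mul, h, h']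
  | smul a x h => simp only [PathAlgebra.smul_mul, h]
  | path p =>
    induction y using induction with
    | zero => simp only [PathAlgebra.zero_mul, PathAlgebra.mul_zero]
    | add y y' h h' => simp only [PathAlgebra.add_mul, PathAlgebra.mul_add, h, h']
    | smul a y h => simp only [PathAlgebra.smul_mul, PathAlgebra.mul_smul, h]
    | path q =>
      induction z using induction with
      | zero => simp only [PathAlgebra.mul_zero]
      | add z z' h h' => simp only [PathAlgebra.mul_add, h, h']
      | smul a z h => simp only [PathAlgebra.mul_smul, h]
      | path r =>
        obtain ⟨a, b, p⟩ := p
        obtain ⟨b', c, q⟩ := q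
        obtain ⟨c', d, r⟩ := r
        simp only [ofPath_mul_ofPath]
        by_cases h₁ : b' = b
        · subst h₁
          by_cases h₂ : c' = c
          · subst h₂
            simp only [mulPath_of_eq, ofPath_mul_ofPath, Quiver.Path.comp_assoc]
          · rw [mulPath_of_eq, ofPath_mul_ofPath, mulPath_of_ne h₂, mulPath_of_ne h₂,
              PathAlgebra.mul_zero]
        · rw [mulPath_of_ne h₁, PathAlgebra.zero_mul]
          by_cases h₂ : c' = c
          · subst h₂
            rw [mulPath_of_eq, ofPath_mul_ofPath, mulPath_of_ne h₁]
          · rw [mulPath_of_ne h₂, PathAlgebra.mul_zero]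

protected theorem one_mul [Fintype V] (x : PathAlgebra k V) : 1 * x = x := by
  induction x using induction with
  | zero => exact PathAlgebra.mul_zero _
  | add x y h h' => rw [PathAlgebra.mul_add, h, h']
  | smul a x h => rw [PathAlgebra.mul_smul, h]
  | path p =>
    obtain ⟨a, b, p⟩ := p
    rw [one_def, mul_def, map_sum, LinearMap.sum_apply, Finset.sum_eq_single a]
    · rw [← mul_def, ofPath_mul_ofPath, mulPath_of_eq, Quiver.Path.nil_comp]
    · intro x _ hx
      rw [← mul_def, ofPath_mul_ofPath, mulPath_of_ne (Ne.symm hx)]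
    · intro h
      exact absurd (Finset.mem_univ a) h

protected theorem mul_one [Fintype V] (x : PathAlgebra k V) : x * 1 = x := by
  induction x using induction with
  | zero => exact PathAlgebra.zero_mul _
  | add x y h h' => rw [PathAlgebra.add_mul, h, h']
  | smul a x h => rw [PathAlgebra.smul_mul, h]
  | path p =>
    obtain ⟨a, b, p⟩ := p
    rw [one_def, mul_def, map_sum, Finset.sum_eq_single b]
    · rw [← mul_def, ofPath_mul_ofPath, mulPath_of_eq, Quiver.Path.comp_nil]
    · intro x _ hx
      rw [← mul_def, ofPath_mul_ofPath, mulPath_of_ne hx]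
    · intro h
      exact absurd (Finset.mem_univ b) h

noncomputable instance [Fintype V] : Ring (PathAlgebra k V) where
  __ := (instAddCommGroup : AddCommGroup (PathAlgebra k V))
  mul := (· * ·)
  one := 1
  left_distrib := PathAlgebra.mul_add
  right_distrib := PathAlgebra.add_mul
  zero_mul := PathAlgebra.zero_mul
  mul_zero := PathAlgebra.mul_zero
  mul_assoc := PathAlgebra.mul_assoc
  one_mul := PathAlgebra.one_mul
  mul_one := PathAlgebra.mul_one

noncomputable instance [Fintype V] : Algebra k (PathAlgebra k V) :=
  Algebra.ofModule PathAlgebra.smul_mul PathAlgebra.mul_smul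

end Ring

end PathAlgebra

/-! ### Gentle algebras -/

section Gentle

variable {k : Type u} {V : Type v} [Field k] [Quiver.{w} V] [Fintype V] [DecidableEq V]

/-- The quotient algebra `k Q / I` of a path algebra by a two-sided ideal. -/
abbrev BoundQuiverAlgebra (I : TwoSidedIdeal (PathAlgebra k V)) : Type (max u v w) :=
  I.ringCon.Quotient

/-- The path `a b` of length two formed by two consecutive arrows `a : x ⟶ y` and `b : y ⟶ z`, as
an element of the path algebra. -/
noncomputable def twoArrowPath (k : Type u) [Field k] {x y z : V} (a : x ⟶ y) (b : y ⟶ z) :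
    PathAlgebra k V :=
  PathAlgebra.ofPath k ⟨x, z, a.toPath.comp b.toPath⟩

/-- `Q` is a finite quiver and `k Q / I` is a gentle algebra (the finiteness of the set of vertices
is the ambient `Fintype V`). -/
structure IsGentle (I : TwoSidedIdeal (PathAlgebra k V)) : Prop where
  finite_arrows : ∀ x y : V, Finite (x ⟶ y)
  /-- At most two arrows end at every vertex. -/
  arrows_ending : ∀ y : V, Nat.card (Σ x : V, (x ⟶ y)) ≤ 2
  /-- At most two arrows start at every vertex. -/
  arrows_starting : ∀ x : V, Nat.card (Σ y : V, (x ⟶ y)) ≤ 2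
  /-- `I` is generated by paths of length two. -/
  generated : ∃ S : Set (QuiverPath V), (∀ p ∈ S, p.2.2.length = 2) ∧
    I = TwoSidedIdeal.span (PathAlgebra.ofPath k '' S)
  /-- For every arrow `a` there is at most one arrow `b` with `a b ∈ I`. -/
  right_mem : ∀ {x y : V} (a : x ⟶ y),
    {b : Σ z : V, (y ⟶ z) | twoArrowPath k a b.2 ∈ I}.Subsingleton
  /-- For every arrow `a` there is at most one arrow `c` with `c a ∈ I`. -/
  left_mem : ∀ {x y : V} (a : x ⟶ y),
    {c : Σ z : V, (z ⟶ x) | twoArrowPath k c.2 a ∈ I}.Subsingleton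
  /-- For every arrow `a` there is at most one arrow `b` with `a b ∉ I`. -/
  right_notMem : ∀ {x y : V} (a : x ⟶ y),
    {b : Σ z : V, (y ⟶ z) | twoArrowPath k a b.2 ∉ I}.Subsingleton
  /-- For every arrow `a` there is at most one arrow `c` with `c a ∉ I`. -/
  left_notMem : ∀ {x y : V} (a : x ⟶ y),
    {c : Σ z : V, (z ⟶ x) | twoArrowPath k c.2 a ∉ I}.Subsingleton
  finiteDimensional : FiniteDimensional k (BoundQuiverAlgebra I)

/-- A maximal path of `k Q / I`: a path `p` that is nonzero in `k Q / I` and satisfies `p a = 0` and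
`a p = 0` in `k Q / I` for every arrow `a`. Only arrows `a` that can be composed with `p` matter,
the product being zero otherwise. -/
def IsMaximalPath (I : TwoSidedIdeal (PathAlgebra k V)) (p : QuiverPath V) : Prop :=
  PathAlgebra.ofPath k p ∉ I ∧
  (∀ (z : V) (a : p.2.1 ⟶ z), PathAlgebra.ofPath k ⟨p.1, z, p.2.2.comp a.toPath⟩ ∈ I) ∧
  (∀ (z : V) (a : z ⟶ p.1), PathAlgebra.ofPath k ⟨z, p.2.1, a.toPath.comp p.2.2⟩ ∈ I)

/-- `k Q / I` is a gentle algebra with exactly one maximal path `p`, and `α` is the permutation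
associated with it. Here `p` has `n = m + 1` vertices (occurring at the positions `0, …, m`), and
the vertices at two different positions `i`, `j` coincide if and only if `α` exchanges `i` and `j`;
so `α i` is the other position with the same vertex as `i` if there is one, and `α i = i`
otherwise. -/
def IsGentleAssociatedTo (I : TwoSidedIdeal (PathAlgebra k V)) {m : ℕ}
    (α : Equiv.Perm (Fin (m + 1))) : Prop :=
  IsGentle I ∧ ∃ p : QuiverPath V, (∀ q, IsMaximalPath I q ↔ q = p) ∧ p.2.2.length = m ∧
    ∀ i j : Fin (m + 1),
      p.2.2.vertices[(i : ℕ)]? = p.2.2.vertices[(j : ℕ)]? ↔ j = i ∨ j = α i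

end Gentle

/-! ### Global dimension -/

/-- The (right) global dimension of a ring: the supremum of the projective dimensions of its right
modules, i.e. of the left modules over the opposite ring. -/
noncomputable def globalDimension (A : Type u) [Ring A] : WithBot ℕ∞ :=
  ⨆ M : ModuleCat.{u} Aᵐᵒᵖ, CategoryTheory.projectiveDimension M

/-! ### Quasi-diagrams

The set `{1, …, n}` with `n = m + 1` is represented by `Fin (m + 1) = {0, …, m}`, so that the points
`1` and `n` become `0` and `Fin.last m`. -/

namespace QuasiDiagram

variable {m : ℕ}

/-- The cycle `ζ = (1 2 ⋯ n)`. -/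
abbrev zeta (m : ℕ) : Equiv.Perm (Fin (m + 1)) := finRotate (m + 1)

/-- A quasi-diagram is a permutation `α` with `α² = id`. -/
def IsQuasiDiagram (α : Equiv.Perm (Fin (m + 1))) : Prop := α * α = 1

/-- An isolated point of `α` is a fixed point. -/
def IsIsolated (α : Equiv.Perm (Fin (m + 1))) (i : Fin (m + 1)) : Prop := α i = i

/-- `α` is regular if every orbit of `ζ α` contains `1` or an isolated point of `α`. -/
def IsRegular (α : Equiv.Perm (Fin (m + 1))) : Prop :=
  ∀ i, ∃ j, (zeta m * α).SameCycle i j ∧ (j = 0 ∨ IsIsolated α j)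

/-- `g_j`: zero for `j = n`, and otherwise the smallest positive integer `g` such that `(α ζ)^g (j)`
is `n` or an isolated point of `α`. -/
noncomputable def gSteps (α : Equiv.Perm (Fin (m + 1))) (j : Fin (m + 1)) : ℕ :=
  if j = Fin.last m then 0 else
    sInf {g : ℕ | 0 < g ∧ (((α * zeta m) ^ g) j = Fin.last m ∨
      IsIsolated α (((α * zeta m) ^ g) j))}

/-- `d_i`: zero for `i = α(n)`, and otherwise the smallest positive integer `d` such that
`(ζ α)^d (i)` is `α(n)` or an isolated point of `α`. -/
noncomputable def dSteps (α : Equiv.Perm (Fin (m + 1))) (i : Fin (m + 1)) : ℕ :=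
  if i = α (Fin.last m) then 0 else
    sInf {d : ℕ | 0 < d ∧ (((zeta m * α) ^ d) i = α (Fin.last m) ∨
      IsIsolated α (((zeta m * α) ^ d) i))}

end QuasiDiagram

/-! Every path that is nonzero in the algebra is a subpath of the maximal path `p`. If its length is
positive it occurs in `p` exactly once, while the trivial path at a vertex occurs at two positions
`i` and `α i`, which may coincide. Sending a path to the indicator matrix of its occurrences thus
identifies `kQ/I` with `gentleMatrices α k` (`IsGentleAssociatedTo.nonempty_ringEquiv`), and the
theorem becomes a computation with row vectors.

Let `R_i` be the right module of rows that start at position `i` (`Row.tail`). If `α i = i`, it is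
projective. Otherwise it is a quotient of the projective module `Row.glued`, and the kernel is
`R_{α(i)+1}`. Taking syzygies of `R_{i+1}` therefore moves `i` along its orbit under `αζ`, until an
isolated point gives a projective module or the last point gives the zero module. Since these
sequences do not split when the kernel is nonzero, `g_i` is one more than the projective dimension
of `R_{i+1}`, and `0` when this module vanishes (`projDimLT_tail_succ`, `not_projDimLT_tail`).

The simple module at `i` is `R_i / R_{i+1}`. Lower bounds for the global dimension come from the
simple modules at isolated points, of projective dimension `g_i`, and from `R_0`, of projective
dimension `g_{α(0)}` if `0` is not isolated. Every module has a finite filtration by direct sums of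
simple modules, which bounds the global dimension by the maximum of `g` over all points. That
maximum is attained at an isolated point or at `α 0`: any other `j` is `αζ(i)` with `g_i = g_j + 1`.
Regularity makes all the `g_i` well defined, and the formula with `d` follows from `d_i = g_{α(i)}`.
-/

open CategoryTheory in
/-- The module `M` has projective dimension less than `n`. -/
abbrev ProjDimLT (R : Type u) [Ring R] (M : Type u) [AddCommGroup M] [Module R M] (n : ℕ) : Prop :=
  HasProjectiveDimensionLT (ModuleCat.of R M) n

/-! ### Projective dimension in exact sequences, direct sums and filtrations -/

namespace ProjDimLT

open CategoryTheory

variable {R : Type u} [Ring R] {M N P : Type u} [AddCommGroup M] [Module R M] [AddCommGroup N]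
  [Module R N] [AddCommGroup P] [Module R P]

theorem zero_iff : ProjDimLT R M 0 ↔ Subsingleton M := by
  rw [ProjDimLT, hasProjectiveDimensionLT_zero_iff_isZero, ModuleCat.isZero_iff_subsingleton]

theorem one_iff : ProjDimLT R M 1 ↔ Module.Projective R M := by
  rw [ProjDimLT, ← projective_iff_hasProjectiveDimensionLT_one, ← IsProjective.iff_projective]

theorem mono {a b : ℕ} (h : a ≤ b) (hM : ProjDimLT R M a) : ProjDimLT R M b :=
  hasProjectiveDimensionLT_of_ge _ a b h

theorem of_subsingleton [Subsingleton M] (n : ℕ) : ProjDimLT R M n :=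
  mono (Nat.zero_le n) (zero_iff.2 ‹_›)

theorem of_equiv (e : M ≃ₗ[R] N) {n : ℕ} (hM : ProjDimLT R M n) : ProjDimLT R N n :=
  hasProjectiveDimensionLT_of_iso e.toModuleIso n

section

variable {f : M →ₗ[R] N} {g : N →ₗ[R] P} (hf : Function.Injective f) (hfg : Function.Exact f g)
  (hg : Function.Surjective g)
include hf hfg hg

theorem shortExact : (ModuleCat.shortComplexOfCompEqZero f g
    hfg.linearMap_comp_eq_zero).ShortExact :=
  ModuleCat.shortComplex_shortExact _ hfg hf hg

theorem middle {n : ℕ} (h₁ : ProjDimLT R M n) (h₃ : ProjDimLT R P n) : ProjDimLT R N n :=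
  (shortExact hf hfg hg).hasProjectiveDimensionLT_X₂ n h₁ h₃

theorem right {n : ℕ} (h₁ : ProjDimLT R M n) (h₂ : ProjDimLT R N (n + 1)) :
    ProjDimLT R P (n + 1) :=
  (shortExact hf hfg hg).hasProjectiveDimensionLT_X₃ n h₁ h₂

theorem right_of_projective [Module.Projective R N] {n : ℕ} (h₁ : ProjDimLT R M n) :
    ProjDimLT R P (n + 1) :=
  right hf hfg hg h₁ (mono (Nat.le_add_left 1 n) (one_iff.2 ‹_›))

theorem right_iff [Module.Projective R N] {n : ℕ} :
    ProjDimLT R P (n + 2) ↔ ProjDimLT R M (n + 1) :=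
  (shortExact hf hfg hg).hasProjectiveDimensionLT_X₃_iff n ((IsProjective.iff_projective N).1 ‹_›)

/-- If `0 → M → N → P → 0` is exact with `N` projective and `P` is not projective, then the
projective dimension of `P` exceeds that of `M`. -/
theorem not_right [Module.Projective R N] {n : ℕ} (hP : ¬ Module.Projective R P)
    (hM : n ≠ 0 → ¬ ProjDimLT R M n) : ¬ ProjDimLT R P (n + 1) := by
  cases n with
  -- Here non-projectivity of `P` is already the claim; `M` may be zero or projective, which is why
  -- `hM` is only required for `n ≠ 0`.
  | zero => rwa [one_iff]
  | succ n => rw [right_iff hf hfg hg]; exact hM n.succ_ne_zero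

end

/-- Direct sums of exact sequences are exact and direct sums of projectives are projective, so a
dimension shift along a free cover of `M` reduces everything to `n = 0` (zero modules) and `n = 1`
(projective modules). -/
theorem finsupp (ι : Type u) {n : ℕ} (hM : ProjDimLT R M n) : ProjDimLT R (ι →₀ M) n := by
  induction n using Nat.strong_induction_on generalizing M with
  | _ n ih =>
  obtain _ | _ | n := n
  · have := zero_iff.1 hM
    exact of_subsingleton _
  · have := one_iff.1 hM
    classical exact one_iff.2 (Module.Projective.of_equiv (finsuppLequivDFinsupp R).symm)
  · let g : (M →₀ R) →ₗ[R] M := Finsupp.linearCombination R id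
    have hg : Function.Surjective g := Finsupp.linearCombination_id_surjective R M
    have hK := (right_iff (M := LinearMap.ker g) (f := (LinearMap.ker g).subtype)
      (LinearMap.ker g).injective_subtype (LinearMap.exact_subtype_ker_map g) hg).1 hM
    have : Module.Projective R (ι →₀ M →₀ R) := by
      classical exact Module.Projective.of_equiv (finsuppLequivDFinsupp R).symm
    refine (right_iff (N := ι →₀ M →₀ R) (f := Finsupp.mapRange.linearMap (LinearMap.ker g).subtype)
      (g := Finsupp.mapRange.linearMap g) ?_ ?_ ?_).2 (ih (n + 1) (by lia) hK)
    · exact Finsupp.mapRange_injective _ (map_zero _) (LinearMap.ker g).injective_subtype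
    · rw [LinearMap.exact_iff, Finsupp.ker_mapRange, Finsupp.range_mapRange_linearMap _ (by simp),
        Submodule.range_subtype]
    · exact Finsupp.mapRange_surjective _ (map_zero _) hg

/-- A module with a finite filtration has projective dimension bounded by the projective dimensions
of the successive quotients. -/
theorem of_filtration (F : ℕ → Submodule R M) (hF : Antitone F) (h₀ : F 0 = ⊤) {d n : ℕ}
    (hd : F d = ⊥)
    (h : ∀ t < d, ∀ (Q : Type u) [AddCommGroup Q] [Module R Q] (p : F t →ₗ[R] Q),
      Function.Surjective p → (∀ x : F t, x.1 ∈ F (t + 1) → p x = 0) → ProjDimLT R Q n) :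
    ProjDimLT R M n := by
  -- Descending induction on `t`, run as an induction on `c = d - t`.
  have key : ∀ c t, t + c = d → ProjDimLT R (F t) n := by
    intro c
    induction c with
    | zero =>
      rintro t rfl
      rw [show F t = ⊥ from hd]
      exact of_subsingleton n
    | succ c ih =>
      intro t ht
      let f := Submodule.inclusion (hF (Nat.le_succ t))
      refine middle (Submodule.inclusion_injective (hF (Nat.le_succ t)))
        (LinearMap.exact_map_mkQ_range f) (Submodule.mkQ_surjective _) (ih (t + 1) (by lia))
        (h t (by lia) _ _ (Submodule.mkQ_surjective (LinearMap.range f)) fun x hx => ?_)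
      rw [Submodule.mkQ_apply, Submodule.Quotient.mk_eq_zero]
      exact ⟨⟨x, hx⟩, rfl⟩
  have h0 := key d 0 (zero_add _)
  rw [h₀] at h0
  exact h0.of_equiv Submodule.topEquiv

end ProjDimLT

/-! ### Bounds for the global dimension and its invariance under ring isomorphisms -/

section GlobalDimension

open CategoryTheory

theorem le_globalDimension {A : Type u} [Ring A] (M : Type u) [AddCommGroup M] [Module Aᵐᵒᵖ M]
    {n : ℕ} (h : ¬ ProjDimLT Aᵐᵒᵖ M n) : (n : WithBot ℕ∞) ≤ globalDimension A :=
  ((projectiveDimension_ge_iff _ n).2 h).trans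
    (le_iSup (fun M : ModuleCat.{u} Aᵐᵒᵖ => projectiveDimension M) (ModuleCat.of _ M))

theorem globalDimension_le {A : Type u} [Ring A] {n : ℕ}
    (h : ∀ (M : Type u) [AddCommGroup M] [Module Aᵐᵒᵖ M], ProjDimLT Aᵐᵒᵖ M (n + 1)) :
    globalDimension A ≤ n :=
  iSup_le fun M => (projectiveDimension_le_iff M n).2 (h M)

attribute [local instance] RingHomInvPair.of_ringEquiv in
theorem globalDimension_le_of_ringEquiv {A B : Type u} [Ring A] [Ring B] (e : A ≃+* B) :
    globalDimension A ≤ globalDimension B := by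
  refine iSup_le fun M => ?_
  let f : Bᵐᵒᵖ ≃+* Aᵐᵒᵖ := RingEquiv.op e.symm
  let _ : Module Bᵐᵒᵖ M := Module.compHom M f.toRingHom
  let e' : ModuleCat.of Bᵐᵒᵖ M ≃ₛₗ[RingHomClass.toRingHom f] M :=
    { AddEquiv.refl M with map_smul' := fun _ _ => rfl }
  rw [← ModuleCat.projectiveDimension_eq_of_semiLinearEquiv f e']
  exact le_iSup (fun M : ModuleCat.{u} Bᵐᵒᵖ => projectiveDimension M) (ModuleCat.of _ M)

theorem globalDimension_eq_of_ringEquiv {A B : Type u} [Ring A] [Ring B] (e : A ≃+* B) :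
    globalDimension A = globalDimension B :=
  le_antisymm (globalDimension_le_of_ringEquiv e) (globalDimension_le_of_ringEquiv e.symm)

end GlobalDimension

/-! ### The matrix algebra and its projective modules of row vectors -/

/-- The matrices that represent the gentle algebra associated with `α`: the upper triangular
matrices whose diagonal entries at `i` and `α i` coincide. -/
def gentleMatrices {m : ℕ} (α : Equiv.Perm (Fin (m + 1))) (K : Type u) [Field K] :
    Subalgebra K (Matrix (Fin (m + 1)) (Fin (m + 1)) K) where
  carrier := {T | T.BlockTriangular id ∧ ∀ i, T (α i) (α i) = T i i}
  mul_mem' := by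
    rintro S T ⟨hS, hS'⟩ ⟨hT, hT'⟩
    refine ⟨hS.mul hT, fun i => ?_⟩
    have key : ∀ i, (S * T) i i = S i i * T i i := fun i => by
      rw [Matrix.mul_apply, Finset.sum_eq_single i]
      · intro j _ hj
        rcases lt_or_gt_of_ne hj with h | h
        · rw [hS h, zero_mul]
        · rw [hT h, mul_zero]
      · simp
    rw [key, key, hS', hT']
  add_mem' := by
    rintro S T ⟨hS, hS'⟩ ⟨hT, hT'⟩
    exact ⟨hS.add hT, fun i => by rw [Matrix.add_apply, Matrix.add_apply, hS', hT']⟩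
  algebraMap_mem' c := by
    refine ⟨fun i j h => ?_, fun i => by simp [Matrix.algebraMap_matrix_apply]⟩
    rw [Matrix.algebraMap_matrix_apply, if_neg (show i ≠ j from ne_of_gt h)]

namespace GentleMatrix

open MulOpposite

variable {m : ℕ} {α : Equiv.Perm (Fin (m + 1))} {K : Type u} [Field K]

/-- A shortcut that makes the semiring structure of the opposite ring come from its ring
structure. -/
instance : Semiring (gentleMatrices α K)ᵐᵒᵖ := Ring.toSemiring

theorem apply_eq_zero (T : gentleMatrices α K) {i j : Fin (m + 1)} (h : j < i) : T.1 i j = 0 :=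
  T.2.1 h

theorem mul_apply_diag (S T : gentleMatrices α K) (i : Fin (m + 1)) :
    (S * T).1 i i = S.1 i i * T.1 i i := by
  change (S.1 * T.1) i i = _
  rw [Matrix.mul_apply, Finset.sum_eq_single i]
  · intro j _ hj
    rcases lt_or_gt_of_ne hj with h | h
    · rw [apply_eq_zero S h, zero_mul]
    · rw [apply_eq_zero T h, mul_zero]
  · simp

/-- The matrix unit at a position above the diagonal. -/
def unit (α : Equiv.Perm (Fin (m + 1))) (K : Type u) [Field K] {i j : Fin (m + 1)} (h : i < j) :
    gentleMatrices α K where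
  val := Matrix.single i j 1
  property := by
    refine ⟨fun a b hab => ?_, fun a => ?_⟩
    · rw [Matrix.single_apply, if_neg]
      rintro ⟨rfl, rfl⟩
      exact lt_asymm h hab
    · rw [Matrix.single_apply_of_ne, Matrix.single_apply_of_ne]
      · rintro ⟨rfl, rfl⟩; exact lt_irrefl _ h
      · rintro ⟨rfl, h'⟩; exact h.ne h'.symm

/-- The row vectors, a right module over `gentleMatrices α K`. -/
@[nolint unusedArguments]
def Row {m : ℕ} (_α : Equiv.Perm (Fin (m + 1))) (K : Type u) : Type u := Fin (m + 1) → K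

namespace Row

instance : AddCommGroup (Row α K) := inferInstanceAs (AddCommGroup (Fin (m + 1) → K))

@[ext] theorem ext {K : Type u} {x y : Row α K} (h : ∀ j, x j = y j) : x = y := funext h

@[simp] theorem zero_apply (j : Fin (m + 1)) : (0 : Row α K) j = 0 := rfl

@[simp] theorem add_apply (x y : Row α K) (j : Fin (m + 1)) : (x + y) j = x j + y j := rfl

instance : Module (gentleMatrices α K)ᵐᵒᵖ (Row α K) where
  smul r x := Matrix.vecMul x r.unop.1
  one_smul x := Matrix.vecMul_one x
  mul_smul r s x := (Matrix.vecMul_vecMul x s.unop.1 r.unop.1).symm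
  smul_zero _ := Matrix.zero_vecMul _
  smul_add _ x y := Matrix.add_vecMul _ x y
  add_smul _ _ x := Matrix.vecMul_add _ _ x
  zero_smul x := Matrix.vecMul_zero x

theorem smul_apply (r : (gentleMatrices α K)ᵐᵒᵖ) (x : Row α K) (j : Fin (m + 1)) :
    (r • x) j = ∑ i, x i * r.unop.1 i j := rfl

theorem unit_smul {i j : Fin (m + 1)} (h : i < j) (x : Row α K) (l : Fin (m + 1)) :
    (op (unit α K h) • x) l = if j = l then x i else 0 := by
  rw [smul_apply, Finset.sum_eq_single i]
  · simp [unit, Matrix.single_apply]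
  · intro b _ hb
    simp [unit, hb.symm]
  · simp

variable (α K) in
/-- The row vectors whose entries before position `i` vanish. -/
def tail (i : ℕ) : Submodule (gentleMatrices α K)ᵐᵒᵖ (Row α K) where
  carrier := {x | ∀ j : Fin (m + 1), (j : ℕ) < i → x j = 0}
  zero_mem' _ _ := rfl
  add_mem' hx hy j hj := by rw [add_apply, hx j hj, hy j hj, add_zero]
  smul_mem' r x hx j hj := by
    rw [smul_apply]
    refine Finset.sum_eq_zero fun l _ => ?_
    rcases lt_or_ge j l with h | h
    · rw [apply_eq_zero r.unop h, mul_zero]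
    · rw [hx l (lt_of_le_of_lt h hj), zero_mul]

theorem tail_anti {i j : ℕ} (h : i ≤ j) : tail α K j ≤ tail α K i :=
  fun _ hx l hl => hx l (hl.trans_le h)

/-- On row vectors that start at `i`, the action on the `i`-th entry is multiplication by the
diagonal entry. -/
theorem smul_apply_self {i : Fin (m + 1)} {x : Row α K} (hx : x ∈ tail α K i)
    (r : (gentleMatrices α K)ᵐᵒᵖ) : (r • x) i = x i * r.unop.1 i i := by
  rw [smul_apply, Finset.sum_eq_single i]
  · intro j _ hj
    rcases lt_or_gt_of_ne hj with h | h
    · rw [hx j h, zero_mul]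
    · rw [apply_eq_zero r.unop h, mul_zero]
  · simp

variable (α) in
/-- The row vector with the single entry `c` at position `i`. -/
def single (i : Fin (m + 1)) (c : K) : tail α K i :=
  ⟨(Pi.single i c : Fin (m + 1) → K), fun _ hj => Pi.single_eq_of_ne (Fin.ne_of_lt hj) _⟩

theorem single_self (i : Fin (m + 1)) (c : K) : (single α i c).1 i = c :=
  Pi.single_eq_same (M := fun _ => K) i c

theorem single_of_ne {i j : Fin (m + 1)} (h : j ≠ i) (c : K) : (single α i c).1 j = 0 :=
  Pi.single_eq_of_ne h _

instance nontrivial_tail (i : Fin (m + 1)) : Nontrivial (tail α K i) :=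
  ⟨single α i 1, 0, fun h => one_ne_zero (α := K) (by rw [← single_self (α := α) i 1, h]; rfl)⟩

instance subsingleton_tail : Subsingleton (tail α K (m + 1)) :=
  ⟨fun x y => by ext j; rw [x.2 j j.2, y.2 j j.2]⟩

/-- The row vectors that start at a fixed point of `α` form a direct summand of the algebra. -/
theorem projective_tail {i : Fin (m + 1)} (hi : α i = i) :
    Module.Projective (gentleMatrices α K)ᵐᵒᵖ (tail α K i) := by
  -- `f` writes a row vector into row `i` of a zero matrix. As `α i = i`, no other diagonal entry is
  -- tied to the one at `i`, so the result lies in the algebra. Reading off row `i` is a retraction.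
  let f : tail α K i →ₗ[(gentleMatrices α K)ᵐᵒᵖ] (gentleMatrices α K)ᵐᵒᵖ :=
    { toFun := fun x => op ⟨Matrix.of fun a b => if a = i then x.1 b else 0, by
        refine ⟨fun a b hab => ?_, fun a => ?_⟩
        · simp only [Matrix.of_apply]
          split_ifs with h
          · exact x.2 b (h ▸ hab)
          · rfl
        · simp only [Matrix.of_apply]
          by_cases h : a = i
          · subst h; rw [hi]
          · rw [if_neg h, if_neg]
            intro h'
            exact h (α.injective (h'.trans hi.symm))⟩
      map_add' := fun x y => by
        apply unop_injective
        ext a b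
        by_cases h : a = i <;> simp [h]
      map_smul' := fun r x => by
        apply unop_injective
        ext a b
        by_cases h : a = i <;> simp [h, Matrix.mul_apply, smul_apply] }
  let g : (gentleMatrices α K)ᵐᵒᵖ →ₗ[(gentleMatrices α K)ᵐᵒᵖ] tail α K i :=
    { toFun := fun r => ⟨fun b => r.unop.1 i b, fun b hb => apply_eq_zero r.unop hb⟩
      map_add' := fun r s => rfl
      map_smul' := fun r s => rfl }
  refine Module.Projective.of_split f g ?_
  ext x b
  exact (if_pos rfl : (if i = i then x.1 b else 0) = x.1 b)

variable (α K) in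
/-- The indecomposable projective module at the vertex `{i, α i}`, if `i ≠ α i`: pairs of rows with
a common leading entry. -/
def glued (i : Fin (m + 1)) : Submodule (gentleMatrices α K)ᵐᵒᵖ (tail α K i × tail α K (α i)) where
  carrier := {x | x.1.1 i = x.2.1 (α i)}
  zero_mem' := rfl
  add_mem' {x y} hx hy := by
    change x.1.1 i + y.1.1 i = x.2.1 (α i) + y.2.1 (α i)
    rw [show x.1.1 i = _ from hx, show y.1.1 i = _ from hy]
  smul_mem' r x hx := by
    change (r • x.1.1) i = (r • x.2.1) (α i)
    rw [smul_apply_self x.1.2, smul_apply_self x.2.2, show x.1.1 i = _ from hx, r.unop.2.2]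

/-- The matrices supported in the rows `i` and `α i` form a direct summand of the algebra; the
common leading entry is exactly the condition on their diagonal. -/
theorem projective_glued (hα : α * α = 1) {i : Fin (m + 1)} (hi : α i ≠ i) :
    Module.Projective (gentleMatrices α K)ᵐᵒᵖ (glued α K i) := by
  have hα' : ∀ a, α (α a) = a := fun a => by rw [← Equiv.Perm.mul_apply, hα]; rfl
  let f : glued α K i →ₗ[(gentleMatrices α K)ᵐᵒᵖ] (gentleMatrices α K)ᵐᵒᵖ :=
    { toFun := fun x => op ⟨Matrix.of fun a b => if a = i then x.1.1.1 b else
          if a = α i then x.1.2.1 b else 0, by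
        refine ⟨fun a b hab => ?_, fun a => ?_⟩
        · simp only [Matrix.of_apply]
          split_ifs with h h
          · exact x.1.1.2 b (h ▸ hab)
          · exact x.1.2.2 b (h ▸ hab)
          · rfl
        · simp only [Matrix.of_apply]
          by_cases h : a = i
          · subst h
            rw [if_neg hi, if_pos rfl, if_pos rfl]
            exact x.2.symm
          · by_cases h' : a = α i
            · subst h'
              rw [hα', if_pos rfl, if_neg h, if_pos rfl]
              exact x.2
            · rw [if_neg h, if_neg h', if_neg (fun e => h' (by rw [← e, hα'])),
                if_neg (fun e => h (α.injective e))]⟩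
      map_add' := fun x y => by
        apply unop_injective
        ext a b
        by_cases h : a = i
        · simp [h]
        · by_cases h' : a = α i <;> simp [h, h', hi]
      map_smul' := fun r x => by
        apply unop_injective
        ext a b
        by_cases h : a = i
        · simp [h, Matrix.mul_apply, smul_apply]
        · by_cases h' : a = α i <;> simp [h, h', Matrix.mul_apply, smul_apply] }
  let g : (gentleMatrices α K)ᵐᵒᵖ →ₗ[(gentleMatrices α K)ᵐᵒᵖ] glued α K i :=
    { toFun := fun r => ⟨(⟨fun b => r.unop.1 i b, fun b hb => apply_eq_zero r.unop hb⟩,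
        ⟨fun b => r.unop.1 (α i) b, fun b hb => apply_eq_zero r.unop hb⟩), (r.unop.2.2 i).symm⟩
      map_add' := fun r s => rfl
      map_smul' := fun r s => rfl }
  refine Module.Projective.of_split f g ?_
  ext x b
  · exact if_pos rfl
  · exact (if_neg hi).trans (if_pos rfl)

end Row

end GentleMatrix

/-! ### Simple modules, and the sequences that compute syzygies -/

namespace GentleMatrix

open MulOpposite

variable {m : ℕ} {α : Equiv.Perm (Fin (m + 1))} {K : Type u} [Field K]

/-- The simple right module at the vertex `{i, α i}`. -/
@[nolint unusedArguments]
def Simple {m : ℕ} (_α : Equiv.Perm (Fin (m + 1))) (K : Type u) (_i : Fin (m + 1)) : Type u := K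

namespace Simple

variable {i : Fin (m + 1)}

instance : AddCommGroup (Simple α K i) := inferInstanceAs (AddCommGroup K)

instance : Nontrivial (Simple α K i) := inferInstanceAs (Nontrivial K)

/-- The simple module at `i` is a copy of the field. -/
def equivField : Simple α K i ≃+ K := AddEquiv.refl K

instance : Module (gentleMatrices α K)ᵐᵒᵖ (Simple α K i) where
  smul r x := equivField.symm (equivField x * r.unop.1 i i)
  one_smul x := show equivField x * (1 : Matrix (Fin (m + 1)) (Fin (m + 1)) K) i i = equivField x by
    rw [Matrix.one_apply_eq, mul_one]
  mul_smul r s x := show equivField x * (s.unop * r.unop).1 i i =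
      equivField x * s.unop.1 i i * r.unop.1 i i by
    rw [mul_apply_diag, mul_assoc]
  smul_zero _ := zero_mul (M₀ := K) _
  smul_add _ x y := add_mul (equivField x) (equivField y) _
  add_smul r s x := mul_add (equivField x) (r.unop.1 i i) (s.unop.1 i i)
  zero_smul x := mul_zero (equivField x)

/-- A module that is killed by all matrices with vanishing `i`-th diagonal entry is a direct sum of
copies of the simple module at `i`. -/
theorem exists_equiv_finsupp (i : Fin (m + 1)) {Q : Type u} [AddCommGroup Q]
    [Module (gentleMatrices α K)ᵐᵒᵖ Q]
    (hQ : ∀ r : (gentleMatrices α K)ᵐᵒᵖ, r.unop.1 i i = 0 → ∀ x : Q, r • x = 0) :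
    ∃ ι : Type u, Nonempty (Q ≃ₗ[(gentleMatrices α K)ᵐᵒᵖ] (ι →₀ Simple α K i)) := by
  let _ : Module K Q := Module.compHom Q (algebraMap K (gentleMatrices α K)ᵐᵒᵖ)
  -- The difference of `r` and the scalar matrix of its `i`-th diagonal entry has vanishing `i`-th
  -- diagonal entry, hence kills `Q`. A basis of `Q` over `K` then gives the decomposition.
  have hs : ∀ (r : (gentleMatrices α K)ᵐᵒᵖ) (x : Q), r • x = r.unop.1 i i • x := fun r x => by
    change r • x = algebraMap K (gentleMatrices α K)ᵐᵒᵖ (r.unop.1 i i) • x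
    rw [← sub_eq_zero, ← sub_smul]
    refine hQ _ ?_ x
    change r.unop.1 i i - (algebraMap K (Matrix (Fin (m + 1)) (Fin (m + 1)) K) _) i i = 0
    rw [Matrix.algebraMap_matrix_apply, if_pos rfl, Algebra.algebraMap_self_apply, sub_self]
  let b := (Module.Basis.ofVectorSpace K Q).repr.toAddEquiv.trans
    (Finsupp.mapRange.addEquiv (equivField (α := α) (i := i)).symm)
  refine ⟨Module.Basis.ofVectorSpaceIndex K Q, ⟨{ b with map_smul' := fun r x => ?_ }⟩⟩
  change b (r • x) = r • b x
  ext j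
  change equivField.symm ((Module.Basis.ofVectorSpace K Q).repr (r • x) j) = r • b x j
  rw [hs, map_smul, Finsupp.smul_apply, smul_eq_mul, mul_comm]
  rfl

/-- The leading entry of a row vector. -/
def leading (i : Fin (m + 1)) :
    Row.tail α K i →ₗ[(gentleMatrices α K)ᵐᵒᵖ] Simple α K i where
  toFun x := equivField.symm (x.1 i)
  map_add' _ _ := rfl
  map_smul' r x := congrArg equivField.symm (Row.smul_apply_self x.2 r)

theorem leading_surjective : Function.Surjective (leading (α := α) (K := K) i) :=
  fun c => ⟨Row.single α i (equivField c), Row.single_self (α := α) i (equivField c)⟩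

theorem exact_leading : Function.Exact
    (Submodule.inclusion (Row.tail_anti (α := α) (K := K) (Nat.le_succ i)))
    (leading (α := α) (K := K) i) := by
  intro x
  refine ⟨fun hx => ⟨⟨x.1, fun j hj => ?_⟩, rfl⟩, ?_⟩
  · rcases (Nat.lt_succ_iff.1 hj).lt_or_eq with h | h
    · exact x.2 j h
    · rw [Fin.ext h]; exact hx
  · rintro ⟨y, rfl⟩
    exact y.2 i (Nat.lt_succ_self i)

/-- A section of `leading` would send a generator to a row with entry `1` at `i`. The matrix unit at
`(i, i + 1)` kills the generator but not this row. -/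
theorem not_projective (h : (i : ℕ) < m) :
    ¬ Module.Projective (gentleMatrices α K)ᵐᵒᵖ (Simple α K i) := by
  intro hP
  obtain ⟨s, hs⟩ := Module.projective_lifting_property (leading (α := α) (K := K) i) LinearMap.id
    leading_surjective
  have hlt : i < (⟨i + 1, Nat.succ_lt_succ h⟩ : Fin (m + 1)) := Nat.lt_succ_self (i : ℕ)
  let e : Simple α K i := equivField.symm 1
  have h1 : (s e).1 i = 1 := LinearMap.congr_fun hs e
  have h2 : op (unit α K hlt) • e = 0 := by
    change (1 * (Matrix.single _ _ 1 : Matrix (Fin (m + 1)) (Fin (m + 1)) K) i i : K) = 0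
    rw [one_mul, Matrix.single_apply, if_neg (fun h => hlt.ne h.2.symm)]
  have h3 : op (unit α K hlt) • s e = 0 := by rw [← map_smul, h2, map_zero]
  have h4 := Row.unit_smul hlt (s e).1 ⟨i + 1, Nat.succ_lt_succ h⟩
  rw [if_pos rfl, h1, ← Submodule.coe_smul, h3] at h4
  exact zero_ne_one h4

end Simple

namespace Row

variable (α K) in
/-- The kernel of the projection of `glued α K i` to its first component. -/
def gluedInr (i : Fin (m + 1)) :
    tail α K ((α i : ℕ) + 1) →ₗ[(gentleMatrices α K)ᵐᵒᵖ] glued α K i where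
  toFun x := ⟨(0, ⟨x.1, tail_anti (Nat.le_succ _) x.2⟩), (x.2 (α i) (Nat.lt_succ_self _)).symm⟩
  map_add' _ _ := by ext <;> simp
  map_smul' _ _ := by ext <;> simp

variable (α K) in
/-- The projection of `glued α K i` to its first component. -/
def gluedFst (i : Fin (m + 1)) : glued α K i →ₗ[(gentleMatrices α K)ᵐᵒᵖ] tail α K i :=
  LinearMap.fst _ _ _ ∘ₗ (glued α K i).subtype

theorem gluedInr_injective (i : Fin (m + 1)) : Function.Injective (gluedInr α K i) :=
  fun _ _ h => Subtype.ext (congrArg (fun z : glued α K i => z.1.2.1) h)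

theorem gluedFst_surjective (i : Fin (m + 1)) : Function.Surjective (gluedFst α K i) :=
  fun x => ⟨⟨(x, single α (α i) (x.1 i)), (single_self _ _).symm⟩, rfl⟩

/-- If the first row vanishes, so does the common leading entry, and the second row starts only
after `α i`. This is the syzygy step `i ↦ α i + 1`. -/
theorem exact_glued (i : Fin (m + 1)) : Function.Exact (gluedInr α K i) (gluedFst α K i) := by
  intro x
  refine ⟨fun hx => ⟨⟨x.1.2.1, fun j hj => ?_⟩, ?_⟩, ?_⟩
  · rcases (Nat.lt_succ_iff.1 hj).lt_or_eq with h | h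
    · exact x.1.2.2 j h
    · rw [Fin.ext h, ← show x.1.1.1 i = x.1.2.1 (α i) from x.2, show x.1.1 = 0 from hx]
      rfl
  · exact Subtype.ext (Prod.ext (show x.1.1 = 0 from hx).symm rfl)
  · rintro ⟨y, rfl⟩
    rfl

/-- A section of `gluedFst` would send the unit row at `i` to a pair whose second row has entry `1`
at `α i`. The matrix unit at `(α i, α i + 1)` kills the unit row but not this pair. -/
theorem not_projective_tail {i : Fin (m + 1)} (hi : α i ≠ i) (h : (α i : ℕ) < m) :
    ¬ Module.Projective (gentleMatrices α K)ᵐᵒᵖ (tail α K i) := by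
  intro hP
  obtain ⟨s, hs⟩ := Module.projective_lifting_property (gluedFst α K i) LinearMap.id
    (gluedFst_surjective i)
  have hlt : α i < (⟨α i + 1, Nat.succ_lt_succ h⟩ : Fin (m + 1)) := Nat.lt_succ_self (α i : ℕ)
  have h0 : (s (single α i 1)).1.1 = single α i 1 := LinearMap.congr_fun hs _
  have h1 : (s (single α i 1)).1.2.1 (α i) = 1 := by
    rw [← show _ = (s (single α i 1)).1.2.1 (α i) from (s (single α i 1)).2, h0, single_self]
  have h2 : op (unit α K hlt) • single α i (1 : K) = 0 := by
    ext l
    change (op (unit α K hlt) • (single α i (1 : K)).1) l = 0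
    rw [unit_smul, single_of_ne hi, ite_self]
  have h3 : op (unit α K hlt) • s (single α i 1) = 0 := by rw [← map_smul, h2, map_zero]
  have h4 := unit_smul hlt (s (single α i 1)).1.2.1 ⟨α i + 1, Nat.succ_lt_succ h⟩
  rw [if_pos rfl, h1] at h4
  have h5 := congrArg (fun x => x.1.2.1 ⟨α i + 1, Nat.succ_lt_succ h⟩) h3
  exact zero_ne_one (h5.symm.trans h4)

end Row

/-! ### Filtering a module by direct sums of simple modules -/

section Filtration

variable (M : Type u) [AddCommGroup M] [Module (gentleMatrices α K)ᵐᵒᵖ M]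

/-- The submodule generated by the multiples by matrices whose columns before `t` vanish. -/
def columnFiltration (t : ℕ) : Submodule (gentleMatrices α K)ᵐᵒᵖ M :=
  Submodule.span _ {x | ∃ (r : (gentleMatrices α K)ᵐᵒᵖ) (y : M),
    (∀ i j : Fin (m + 1), (j : ℕ) < t → r.unop.1 i j = 0) ∧ r • y = x}

theorem columnFiltration_zero : columnFiltration (α := α) (K := K) M 0 = ⊤ :=
  top_le_iff.1 fun x _ =>
    Submodule.subset_span ⟨1, x, fun _ _ h => absurd h (Nat.not_lt_zero _), one_smul _ x⟩

theorem columnFiltration_last : columnFiltration (α := α) (K := K) M (m + 1) = ⊥ := by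
  refine Submodule.span_eq_bot.2 ?_
  rintro _ ⟨r, y, hr, rfl⟩
  rw [show r = 0 from unop_injective (Subtype.ext (Matrix.ext fun i j => hr i j j.2)), zero_smul]

theorem columnFiltration_succ_le (t : ℕ) :
    columnFiltration (α := α) (K := K) M (t + 1) ≤ columnFiltration M t :=
  Submodule.span_mono fun _ ⟨r, y, hr, h⟩ => ⟨r, y, fun i j hj => hr i j (hj.trans t.lt_succ_self), h⟩

variable {M} in
-- If the columns of `s` before `t` vanish, then by triangularity column `t` of `s r` is column `t`
-- of `s` times `r t t`. So the `t`-th quotient of the filtration is a direct sum of copies of the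
-- simple module at `t`.
theorem smul_mem_columnFiltration_succ (t : Fin (m + 1)) {x : M}
    (hx : x ∈ columnFiltration (α := α) (K := K) M t) (r : (gentleMatrices α K)ᵐᵒᵖ)
    (hr : r.unop.1 t t = 0) : r • x ∈ columnFiltration (α := α) (K := K) M (t + 1) := by
  induction hx using Submodule.span_induction generalizing r with
  | mem x h =>
    obtain ⟨s, y, hs, rfl⟩ := h
    rw [← mul_smul]
    refine Submodule.subset_span ⟨_, y, fun i j hj => ?_, rfl⟩
    change (s.unop.1 * r.unop.1) i j = 0
    rw [Matrix.mul_apply]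
    refine Finset.sum_eq_zero fun l _ => ?_
    rcases lt_trichotomy l t with h | rfl | h
    · rw [hs i l h, zero_mul]
    · rcases (Nat.lt_succ_iff.1 hj).lt_or_eq with h | h
      · rw [apply_eq_zero r.unop h, mul_zero]
      · rw [Fin.ext h, hr, mul_zero]
    · rw [apply_eq_zero r.unop (lt_of_le_of_lt (Nat.lt_succ_iff.1 hj : j ≤ t) h), mul_zero]
  | zero => rw [smul_zero]; exact zero_mem _
  | add x y _ _ hx hy => rw [smul_add]; exact add_mem (hx r hr) (hy r hr)
  | smul a x _ hx =>
    rw [← mul_smul]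
    refine hx _ ?_
    rw [unop_mul, mul_apply_diag, hr, mul_zero]

/-- The projective dimension of a module is bounded by those of the simple modules. -/
theorem projDimLT_of_simple {n : ℕ}
    (h : ∀ i, ProjDimLT (gentleMatrices α K)ᵐᵒᵖ (Simple α K i) n) :
    ProjDimLT (gentleMatrices α K)ᵐᵒᵖ M n := by
  refine ProjDimLT.of_filtration (columnFiltration (α := α) (K := K) M)
    (antitone_nat_of_succ_le (columnFiltration_succ_le M)) (columnFiltration_zero M)
    (columnFiltration_last M) fun t ht Q _ _ p hp hker => ?_
  obtain ⟨ι, ⟨e⟩⟩ := Simple.exists_equiv_finsupp (α := α) (K := K) (Q := Q) ⟨t, ht⟩ (by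
    intro r hr x
    obtain ⟨x, rfl⟩ := hp x
    rw [← map_smul]
    exact hker _ (smul_mem_columnFiltration_succ ⟨t, ht⟩ x.2 r hr))
  exact ((h _).finsupp ι).of_equiv e.symm

end Filtration

/-! ### Projective dimensions in terms of the step function -/

section Dimension

theorem projDimLT_tail (hα : α * α = 1) {i : Fin (m + 1)} (hi : α i ≠ i) {n : ℕ}
    (h : ProjDimLT (gentleMatrices α K)ᵐᵒᵖ (Row.tail α K (α i + 1)) n) :
    ProjDimLT (gentleMatrices α K)ᵐᵒᵖ (Row.tail α K i) (n + 1) := by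
  have := Row.projective_glued (K := K) hα hi
  exact ProjDimLT.right_of_projective (M := Row.tail α K (α i + 1)) (N := Row.glued α K i)
    (P := Row.tail α K i) (f := Row.gluedInr α K i) (g := Row.gluedFst α K i)
    (Row.gluedInr_injective i) (Row.exact_glued i)
    (Row.gluedFst_surjective i) h

theorem not_projDimLT_tail_of_succ (hα : α * α = 1) {i : Fin (m + 1)} (hi : α i ≠ i)
    (hl : α i ≠ Fin.last m) {n : ℕ}
    (h : n ≠ 0 → ¬ ProjDimLT (gentleMatrices α K)ᵐᵒᵖ (Row.tail α K (α i + 1)) n) :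
    ¬ ProjDimLT (gentleMatrices α K)ᵐᵒᵖ (Row.tail α K i) (n + 1) := by
  have := Row.projective_glued (K := K) hα hi
  exact ProjDimLT.not_right (M := Row.tail α K (α i + 1)) (N := Row.glued α K i)
    (P := Row.tail α K i) (f := Row.gluedInr α K i) (g := Row.gluedFst α K i)
    (Row.gluedInr_injective i) (Row.exact_glued i)
    (Row.gluedFst_surjective i) (Row.not_projective_tail (K := K) hi (Fin.val_lt_last hl)) h

theorem projDimLT_simple_of_tail {i : Fin (m + 1)} {n : ℕ}
    (h₁ : ProjDimLT (gentleMatrices α K)ᵐᵒᵖ (Row.tail α K (i + 1)) n)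
    (h₂ : ProjDimLT (gentleMatrices α K)ᵐᵒᵖ (Row.tail α K i) (n + 1)) :
    ProjDimLT (gentleMatrices α K)ᵐᵒᵖ (Simple α K i) (n + 1) :=
  ProjDimLT.right (M := Row.tail α K (i + 1)) (N := Row.tail α K i) (P := Simple α K i)
    (f := Submodule.inclusion (Row.tail_anti (Nat.le_succ i))) (g := Simple.leading i)
    (Submodule.inclusion_injective _) Simple.exact_leading
    Simple.leading_surjective h₁ h₂

theorem not_projDimLT_simple_of_tail {i : Fin (m + 1)} (hi : α i = i) (hl : i ≠ Fin.last m)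
    {n : ℕ} (h : n ≠ 0 → ¬ ProjDimLT (gentleMatrices α K)ᵐᵒᵖ (Row.tail α K (i + 1)) n) :
    ¬ ProjDimLT (gentleMatrices α K)ᵐᵒᵖ (Simple α K i) (n + 1) := by
  have := Row.projective_tail (K := K) hi
  exact ProjDimLT.not_right (M := Row.tail α K (i + 1)) (N := Row.tail α K i) (P := Simple α K i)
    (f := Submodule.inclusion (Row.tail_anti (Nat.le_succ i))) (g := Simple.leading i)
    (Submodule.inclusion_injective _) Simple.exact_leading
    Simple.leading_surjective (Simple.not_projective (Fin.val_lt_last hl)) h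

variable (hα : α * α = 1) {g : Fin (m + 1) → ℕ} (hlast : g (Fin.last m) = 0)
  (hfix : ∀ i, i ≠ Fin.last m → α (finRotate _ i) = finRotate _ i → g i = 1)
  (hstep : ∀ i, i ≠ Fin.last m → α (finRotate _ i) ≠ finRotate _ i →
    g i = g (α (finRotate _ i)) + 1)

include hα hlast hfix hstep

/-- The three rules for `g` mirror the three cases for the rows that start after `i`: the zero
module, a projective module, or a module whose syzygy consists of the rows that start after `α (i +
1)`. Since `g` drops in the last case, induction on its value applies. -/
theorem projDimLT_tail_succ (i : Fin (m + 1)) :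
    ProjDimLT (gentleMatrices α K)ᵐᵒᵖ (Row.tail α K (i + 1)) (g i) := by
  induction hn : g i using Nat.strong_induction_on generalizing i with
  | _ n ih =>
  subst hn
  by_cases hi : i = Fin.last m
  · subst hi
    rw [hlast, ProjDimLT.zero_iff]
    exact Row.subsingleton_tail
  · rw [← coe_finRotate_of_ne_last hi]
    by_cases hf : α (finRotate _ i) = finRotate _ i
    · rw [hfix i hi hf, ProjDimLT.one_iff]
      exact Row.projective_tail hf
    · rw [hstep i hi hf]
      exact projDimLT_tail hα hf (ih (g (α (finRotate _ i)))
        (by rw [hstep i hi hf]; exact Nat.lt_succ_self _) _ rfl)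

theorem projDimLT_simple {n : ℕ} (hn : ∀ i, g i ≤ n) (i : Fin (m + 1)) :
    ProjDimLT (gentleMatrices α K)ᵐᵒᵖ (Simple α K i) (n + 1) := by
  have h1 : ∀ i : Fin (m + 1), ProjDimLT (gentleMatrices α K)ᵐᵒᵖ (Row.tail α K (i + 1)) n := fun i =>
    (projDimLT_tail_succ hα hlast hfix hstep i).mono (hn i)
  refine projDimLT_simple_of_tail (h1 i) ?_
  by_cases hf : α i = i
  · exact (ProjDimLT.one_iff.2 (Row.projective_tail hf)).mono (Nat.le_add_left 1 n)
  · exact projDimLT_tail hα hf (h1 (α i))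

/-- The same syzygies, now with the fact that each sequence with nonzero kernel does not split. The
bound is indexed by `α i` because the first syzygy is the module of rows after `α i`. -/
theorem not_projDimLT_tail {i : Fin (m + 1)} (hi : α i ≠ i) :
    ¬ ProjDimLT (gentleMatrices α K)ᵐᵒᵖ (Row.tail α K i) (g (α i)) := by
  induction hn : g (α i) using Nat.strong_induction_on generalizing i with
  | _ n ih =>
  subst hn
  by_cases hl : α i = Fin.last m
  · rw [hl, hlast, ProjDimLT.zero_iff, not_subsingleton_iff_nontrivial]
    infer_instance
  · by_cases hf : α (finRotate _ (α i)) = finRotate _ (α i)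
    · rw [hfix _ hl hf]
      exact not_projDimLT_tail_of_succ hα hi hl (n := 0) (fun h => absurd rfl h)
    · have hs := hstep _ hl hf
      rw [hs]
      refine not_projDimLT_tail_of_succ hα hi hl fun _ => ?_
      rw [← coe_finRotate_of_ne_last hl]
      exact ih _ (by rw [hs]; exact Nat.lt_succ_self _) hf rfl

theorem not_projDimLT_simple (i : Fin (m + 1)) (hi : α i = i) :
    ¬ ProjDimLT (gentleMatrices α K)ᵐᵒᵖ (Simple α K i) (g i) := by
  by_cases hl : i = Fin.last m
  · rw [hl, hlast, ProjDimLT.zero_iff, not_subsingleton_iff_nontrivial]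
    infer_instance
  · by_cases hf : α (finRotate _ i) = finRotate _ i
    · rw [hfix _ hl hf]
      exact not_projDimLT_simple_of_tail hi hl (n := 0) (fun h => absurd rfl h)
    · rw [hstep _ hl hf]
      refine not_projDimLT_simple_of_tail hi hl fun _ => ?_
      rw [← coe_finRotate_of_ne_last hl]
      exact not_projDimLT_tail hα hlast hfix hstep hf

/-- The global dimension of `gentleMatrices α K`, in terms of the step function `g`. -/
theorem isGreatest_globalDimension (hmax : ∃ j, (α j = j ∨ j = α 0) ∧ ∀ i, g i ≤ g j) :
    IsGreatest {x : WithBot ℕ∞ | ∃ j, (α j = j ∨ j = α 0) ∧ x = (g j : ℕ)}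
      (globalDimension (gentleMatrices α K)) := by
  have hα' : ∀ a, α (α a) = a := fun a => by rw [← Equiv.Perm.mul_apply, hα]; rfl
  have hle : ∀ j, (α j = j ∨ j = α 0) → ((g j : ℕ) : WithBot ℕ∞) ≤
      globalDimension (gentleMatrices α K) := by
    intro j hj
    by_cases hf : α j = j
    · exact le_globalDimension _ (not_projDimLT_simple hα hlast hfix hstep j hf)
    -- For `j = α 0` not isolated the witness is the module of all row vectors, whose first syzygy
    -- consists of the rows after `α 0`.
    · obtain rfl := hj.resolve_left hf
      exact le_globalDimension _ (not_projDimLT_tail (i := 0) hα hlast hfix hstep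
        fun h => hf (by rw [h, h]))
  refine ⟨?_, ?_⟩
  · obtain ⟨j, hj, hmax⟩ := hmax
    exact ⟨j, hj, le_antisymm (globalDimension_le fun M _ _ =>
      projDimLT_of_simple M (projDimLT_simple hα hlast hfix hstep hmax)) (hle j hj)⟩
  · rintro _ ⟨j, hj, rfl⟩
    exact hle j hj

end Dimension

end GentleMatrix

/-! ### Decompositions of paths and occurrences of subpaths -/

namespace Quiver.Path

variable {V : Type v} [Quiver.{w} V]

/-- The list of arrows of a path. -/
def arrows {a : V} : ∀ {b : V}, Path a b → List (Σ x y : V, x ⟶ y)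
  | _, nil => []
  | _, cons p e => p.arrows ++ [⟨_, _, e⟩]

@[simp] theorem arrows_nil {a : V} : (nil : Path a a).arrows = [] := rfl

@[simp] theorem arrows_cons {a b c : V} (p : Path a b) (e : b ⟶ c) :
    (p.cons e).arrows = p.arrows ++ [⟨b, c, e⟩] := rfl

@[simp] theorem arrows_toPath {a b : V} (e : a ⟶ b) : e.toPath.arrows = [⟨a, b, e⟩] := rfl

@[simp] theorem arrows_comp {a b c : V} (p : Path a b) (q : Path b c) :
    (p.comp q).arrows = p.arrows ++ q.arrows := by
  induction q with
  | nil => simp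
  | cons q e ih => simp [ih]

@[simp] theorem length_arrows {a b : V} (p : Path a b) : p.arrows.length = p.length := by
  induction p with
  | nil => rfl
  | cons p e ih => simp [ih]

theorem exists_comp_of_arrows_eq_append {a b : V} {p : Path a b} {l₁ l₂ : List (Σ x y : V, x ⟶ y)}
    (h : p.arrows = l₁ ++ l₂) :
    ∃ (c : V) (p₁ : Path a c) (p₂ : Path c b), p = p₁.comp p₂ ∧ p₁.arrows = l₁ ∧
      p₂.arrows = l₂ := by
  obtain ⟨c, p₁, p₂, rfl, hl⟩ := p.exists_eq_comp_of_le_length (n := l₁.length) (by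
    rw [← length_arrows, h, List.length_append]; lia)
  rw [arrows_comp] at h
  obtain ⟨h₁, h₂⟩ := List.append_inj h (by rw [length_arrows, hl])
  exact ⟨c, p₁, p₂, rfl, h₁, h₂⟩

/-- Trivial paths are excluded because an empty list of arrows forgets the vertex. -/
theorem sigma_eq_of_arrows_eq {a b a' b' : V} {p : Path a b} {p' : Path a' b'}
    (h : p.arrows = p'.arrows) (hp : p.length ≠ 0) :
    (⟨a, b, p⟩ : QuiverPath V) = ⟨a', b', p'⟩ := by
  induction p generalizing b' with
  | nil => exact absurd rfl hp
  | cons p e ih =>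
    cases p' with
    | nil => simp at h
    | cons p' e' =>
      obtain ⟨h₁, h₂⟩ := List.append_inj' h rfl
      obtain ⟨rfl, h₂⟩ := Sigma.mk.inj (List.singleton_inj.1 h₂)
      obtain ⟨rfl, h₂⟩ := Sigma.mk.inj (eq_of_heq h₂)
      obtain rfl := eq_of_heq h₂
      by_cases h0 : p.length = 0
      · have h0' : p'.length = 0 := by rw [← length_arrows, ← h₁, length_arrows, h0]
        obtain rfl := eq_of_length_zero p h0
        obtain rfl := eq_of_length_zero p' h0'
        rw [eq_nil_of_length_zero p h0, eq_nil_of_length_zero p' h0']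
      · obtain ⟨rfl, h₃⟩ := Sigma.mk.inj (ih h₁ h0)
        obtain ⟨_, h₃⟩ := Sigma.mk.inj (eq_of_heq h₃)
        rw [eq_of_heq h₃]

/-- The decomposition of a path is determined by the length of the first part. -/
theorem sigma_eq_of_comp_eq_comp {x y y' z : V} {a : Path x y} {b : Path y z} {a' : Path x y'}
    {b' : Path y' z} (h : a.comp b = a'.comp b') (hl : a.length = a'.length) :
    (⟨y, a, b⟩ : Σ y, Path x y × Path y z) = ⟨y', a', b'⟩ := by
  have hl' : b.length = b'.length := by
    have := congrArg length h
    simp only [length_comp] at this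
    lia
  induction b with
  | nil =>
    obtain rfl := eq_of_length_zero b' hl'.symm
    obtain rfl := eq_nil_of_length_zero b' hl'.symm
    rw [show a = a' from h]
  | cons b e ih =>
    cases b' with
    | nil => simp at hl'
    | cons b' e' =>
      simp only [comp_cons] at h
      obtain rfl := obj_eq_of_cons_eq_cons h
      obtain rfl := eq_of_heq (hom_heq_of_cons_eq_cons h)
      have h2 := ih (eq_of_heq (heq_of_cons_eq_cons h)) (by simpa using hl')
      obtain ⟨rfl, h3⟩ := Sigma.mk.inj h2
      obtain ⟨rfl, rfl⟩ := Prod.mk.inj (eq_of_heq h3)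
      rfl

theorem getElem?_vertices_eq_some_iff {a b : V} (p : Path a b) (i : ℕ) (x : V) :
    p.vertices[i]? = some x ↔
      ∃ (p₁ : Path a x) (p₂ : Path x b), p = p₁.comp p₂ ∧ p₁.length = i := by
  constructor
  · intro h
    obtain ⟨hi, rfl⟩ := List.getElem?_eq_some_iff.1 h
    obtain ⟨v, p₁, p₂, h₁, h₂, rfl⟩ := p.exists_eq_comp_and_length_eq_of_lt_length i hi
    exact ⟨p₁, p₂, h₁, h₂⟩
  · rintro ⟨p₁, p₂, rfl, rfl⟩
    exact List.getElem?_eq_some_iff.2 ⟨by simp, vertices_comp_get_length_eq p₁ p₂⟩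

end Quiver.Path

namespace QuiverPath

open Quiver

variable {V : Type v} [Quiver.{w} V]

/-- The path `q` occurs in `p`, between the positions `i` and `j`. -/
def Occurs (p q : QuiverPath V) (i j : ℕ) : Prop :=
  ∃ (a : Path p.1 q.1) (b : Path q.2.1 p.2.1), p.2.2 = a.comp (q.2.2.comp b) ∧
    a.length = i ∧ a.length + q.2.2.length = j

namespace Occurs

variable {p q r : QuiverPath V} {i j l : ℕ}

theorem add_length (h : Occurs p q i j) : i + q.2.2.length = j := by
  obtain ⟨a, b, _, rfl, h⟩ := h
  exact h

theorem le (h : Occurs p q i j) : i ≤ j := h.add_length ▸ Nat.le_add_right _ _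

theorem le_length (h : Occurs p q i j) : j ≤ p.2.2.length := by
  obtain ⟨a, b, h, rfl, rfl⟩ := h
  rw [h, Path.length_comp, Path.length_comp]
  lia

theorem eq (h : Occurs p q i j) (h' : Occurs p r i j) : q = r := by
  obtain ⟨x, y, q⟩ := q
  obtain ⟨x', y', r⟩ := r
  obtain ⟨a, b, h, rfl, rfl⟩ := h
  obtain ⟨a', b', h', hi, hj⟩ := h'
  dsimp only at *
  obtain ⟨rfl, h2⟩ := Sigma.mk.inj (Path.sigma_eq_of_comp_eq_comp (h.symm.trans h') hi.symm)
  obtain ⟨rfl, h4⟩ := Prod.mk.inj (eq_of_heq h2)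
  obtain ⟨rfl, h3⟩ := Sigma.mk.inj (Path.sigma_eq_of_comp_eq_comp h4 (by lia))
  obtain ⟨rfl, _⟩ := Prod.mk.inj (eq_of_heq h3)
  rfl

theorem exists_of_le (p : QuiverPath V) (hij : i ≤ j) (hj : j ≤ p.2.2.length) :
    ∃ q, Occurs p q i j := by
  obtain ⟨s, t, p⟩ := p
  obtain ⟨y, p', b, rfl, rfl⟩ := p.exists_eq_comp_of_le_length hj
  obtain ⟨x, a, q, rfl, rfl⟩ := p'.exists_eq_comp_of_le_length hij
  exact ⟨⟨x, y, q⟩, a, b, by simp, rfl, by simp⟩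

theorem nil_iff {x : V} :
    Occurs p ⟨x, x, Path.nil⟩ i j ↔ i = j ∧ p.2.2.vertices[i]? = some x := by
  rw [Path.getElem?_vertices_eq_some_iff]
  constructor
  · rintro ⟨a, b, h, rfl, rfl⟩
    exact ⟨rfl, a, b, by simpa using h, rfl⟩
  · rintro ⟨rfl, a, b, h, rfl⟩
    exact ⟨a, b, by simpa using h, rfl, rfl⟩

theorem comp {x y z : V} {q : Path x y} {r : Path y z} (h : Occurs p ⟨x, y, q⟩ i j)
    (h' : Occurs p ⟨y, z, r⟩ j l) : Occurs p ⟨x, z, q.comp r⟩ i l := by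
  obtain ⟨a, b, h, rfl, rfl⟩ := h
  obtain ⟨a', b', h', hi, rfl⟩ := h'
  dsimp only at *
  rw [← Path.comp_assoc] at h
  have := (Path.comp_inj' (by simp [hi])).1 (h.symm.trans h')
  refine ⟨a, b', ?_, rfl, by simp [hi]; lia⟩
  rw [h', ← this.1]
  simp

theorem of_comp {x y z : V} {q : Path x y} {r : Path y z} (h : Occurs p ⟨x, z, q.comp r⟩ i l) :
    Occurs p ⟨x, y, q⟩ i (i + q.length) ∧ Occurs p ⟨y, z, r⟩ (i + q.length) l := by
  obtain ⟨a, b, h, rfl, rfl⟩ := h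
  exact ⟨⟨a, r.comp b, by simpa using h, rfl, rfl⟩,
    ⟨a.comp q, b, by simpa using h, by simp, by simp; lia⟩⟩

theorem end_eq (h : Occurs p q i j) (h' : Occurs p r j l) : r.1 = q.2.1 := by
  obtain ⟨x, y, q⟩ := q
  obtain ⟨x', y', r⟩ := r
  obtain ⟨a, b, h, rfl, rfl⟩ := h
  obtain ⟨a', b', h', hi, hj⟩ := h'
  dsimp only at *
  rw [← Path.comp_assoc] at h
  exact (Sigma.mk.inj (Path.sigma_eq_of_comp_eq_comp (h.symm.trans h') (by simp [hi]))).1.symm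

end Occurs

/-- A path is reduced with respect to a set of paths of length two if it has no subpath in the
set. -/
def Reduced (S : Set (QuiverPath V)) (q : QuiverPath V) : Prop :=
  q.2.2.arrows.IsChain fun u v => ∀ s ∈ S, s.2.2.arrows ≠ [u, v]

namespace Reduced

variable {S : Set (QuiverPath V)} {p q : QuiverPath V}

theorem of_infix (hp : Reduced S p) (h : q.2.2.arrows <:+: p.2.2.arrows) : Reduced S q :=
  List.IsChain.infix hp h

theorem of_occurs (hp : Reduced S p) {i j : ℕ} (h : Occurs p q i j) : Reduced S q := by
  obtain ⟨a, b, h, -, -⟩ := h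
  refine hp.of_infix ⟨a.arrows, b.arrows, ?_⟩
  rw [h]
  simp

end Reduced

end QuiverPath

section

open Quiver QuiverPath

namespace PathAlgebra

variable {k : Type u} {V : Type v} [Field k] [Quiver.{w} V] [Fintype V] [DecidableEq V]

/-! ### Monomial ideals: membership is read off the coefficients of the reduced paths -/

section Monomial

variable (k) in
/-- The span of the paths with a subpath in `S`. -/
noncomputable def monomialSubmodule (S : Set (QuiverPath V)) : Submodule k (PathAlgebra k V) :=
  Submodule.span k (basis k V '' {q | ¬ Reduced S q})

theorem mem_monomialSubmodule {S : Set (QuiverPath V)} {x : PathAlgebra k V} :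
    x ∈ monomialSubmodule k S ↔ ∀ q, Reduced S q → (basis k V).repr x q = 0 := by
  rw [monomialSubmodule, Module.Basis.mem_span_image]
  refine ⟨fun h q hq => ?_, fun h q hq hq' => ?_⟩
  · by_contra hne
    exact h (Finsupp.mem_support_iff.2 hne) hq
  · exact Finsupp.mem_support_iff.1 hq (h q hq')

theorem ofPath_mem_monomialSubmodule {S : Set (QuiverPath V)} {q : QuiverPath V} :
    ofPath k q ∈ monomialSubmodule k S ↔ ¬ Reduced S q := by
  refine ⟨fun h hq => ?_, fun h => Submodule.subset_span ⟨q, h, rfl⟩⟩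
  have := mem_monomialSubmodule.1 h q hq
  rw [← basis_apply, Module.Basis.repr_self, Finsupp.single_eq_same] at this
  exact one_ne_zero this

theorem mul_mem_monomialSubmodule_left {S : Set (QuiverPath V)} (x : PathAlgebra k V)
    {y : PathAlgebra k V} (hy : y ∈ monomialSubmodule k S) : x * y ∈ monomialSubmodule k S := by
  induction x using induction with
  | zero => rw [zero_mul]; exact zero_mem _
  | add x x' h h' => rw [add_mul]; exact add_mem h h'
  | smul a x h => rw [smul_mul_assoc]; exact Submodule.smul_mem _ _ h
  | path p =>
    induction hy using Submodule.span_induction with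
    | mem y hy =>
      obtain ⟨q, hq, rfl⟩ := hy
      rw [basis_apply, ofPath_mul_ofPath]
      obtain ⟨a, b, p⟩ := p
      obtain ⟨b', c, q⟩ := q
      by_cases h : b' = b
      · subst h
        rw [mulPath_of_eq, ofPath_mem_monomialSubmodule]
        exact fun h => hq (h.of_infix ⟨p.arrows, [], by simp⟩)
      · rw [mulPath_of_ne h]; exact zero_mem _
    | zero => rw [mul_zero]; exact zero_mem _
    | add y y' _ _ h h' => rw [mul_add]; exact add_mem h h'
    | smul a y _ h => rw [mul_smul_comm]; exact Submodule.smul_mem _ _ h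

theorem mul_mem_monomialSubmodule_right {S : Set (QuiverPath V)} {x : PathAlgebra k V}
    (y : PathAlgebra k V) (hx : x ∈ monomialSubmodule k S) : x * y ∈ monomialSubmodule k S := by
  induction y using induction with
  | zero => rw [mul_zero]; exact zero_mem _
  | add x x' h h' => rw [mul_add]; exact add_mem h h'
  | smul a x h => rw [mul_smul_comm]; exact Submodule.smul_mem _ _ h
  | path q =>
    induction hx using Submodule.span_induction with
    | mem x hx =>
      obtain ⟨p, hp, rfl⟩ := hx
      rw [basis_apply, ofPath_mul_ofPath]
      obtain ⟨a, b, p⟩ := p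
      obtain ⟨b', c, q⟩ := q
      by_cases h : b' = b
      · subst h
        rw [mulPath_of_eq, ofPath_mem_monomialSubmodule]
        exact fun h => hp (h.of_infix ⟨[], q.arrows, by simp⟩)
      · rw [mulPath_of_ne h]; exact zero_mem _
    | zero => rw [zero_mul]; exact zero_mem _
    | add y y' _ _ h h' => rw [add_mul]; exact add_mem h h'
    | smul a y _ h => rw [smul_mul_assoc]; exact Submodule.smul_mem _ _ h

theorem smul_mem_twoSidedIdeal (I : TwoSidedIdeal (PathAlgebra k V)) (c : k) {x : PathAlgebra k V}
    (hx : x ∈ I) : c • x ∈ I := by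
  rw [← one_mul x, ← smul_mul_assoc]
  exact I.mul_mem_left _ _ hx

theorem ofPath_mem_span_of_not_reduced {S : Set (QuiverPath V)}
    (hS : ∀ s ∈ S, s.2.2.length = 2) {q : QuiverPath V} (hq : ¬ Reduced S q) :
    ofPath k q ∈ TwoSidedIdeal.span (ofPath k '' S) := by
  rw [Reduced, List.isChain_iff_forall_rel_of_append_cons_cons] at hq
  push Not at hq
  obtain ⟨u, v, l₁, l₂, hl, s, hs, hsuv⟩ := hq
  obtain ⟨a, b, q⟩ := q
  dsimp only at hl
  obtain ⟨c, q₁, q', rfl, -, hq'⟩ := Path.exists_comp_of_arrows_eq_append hl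
  obtain ⟨d, q₂, q₃, rfl, hq₂, -⟩ :=
    Path.exists_comp_of_arrows_eq_append (show q'.arrows = [u, v] ++ l₂ from hq')
  obtain rfl : s = ⟨c, d, q₂⟩ :=
    Path.sigma_eq_of_arrows_eq (hsuv.trans hq₂.symm) (by rw [hS s hs]; exact two_ne_zero)
  rw [← mulPath_of_eq, ← ofPath_mul_ofPath, ← mulPath_of_eq, ← ofPath_mul_ofPath]
  exact TwoSidedIdeal.mul_mem_left _ _ _
    (TwoSidedIdeal.mul_mem_right _ _ _ (TwoSidedIdeal.subset_span ⟨_, hs, rfl⟩))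

/-- Concatenation cannot remove a subpath in `S`, so the non-reduced paths span a two-sided ideal.
It contains `S`, and each non-reduced path is a multiple of an element of `S`. -/
theorem mem_span_iff {S : Set (QuiverPath V)} (hS : ∀ s ∈ S, s.2.2.length = 2)
    {x : PathAlgebra k V} :
    x ∈ TwoSidedIdeal.span (ofPath k '' S) ↔ ∀ q, Reduced S q → (basis k V).repr x q = 0 := by
  rw [← mem_monomialSubmodule]
  constructor
  · let J : TwoSidedIdeal (PathAlgebra k V) := TwoSidedIdeal.mk' (monomialSubmodule k S)
      (zero_mem _) add_mem neg_mem (mul_mem_monomialSubmodule_left _)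
      (mul_mem_monomialSubmodule_right _)
    have hJ : TwoSidedIdeal.span (ofPath k '' S) ≤ J := by
      rw [TwoSidedIdeal.span_le]
      rintro _ ⟨s, hs, rfl⟩
      refine (TwoSidedIdeal.mem_mk' _ _ _ _ _ _ _).2 ?_
      refine ofPath_mem_monomialSubmodule.2 fun h => ?_
      have hl : s.2.2.arrows.length = 2 := by rw [Path.length_arrows, hS s hs]
      obtain ⟨u, v, huv⟩ := List.length_eq_two.1 hl
      rw [Reduced, huv, List.isChain_cons_cons] at h
      exact h.1 s hs huv
    exact fun hx => (TwoSidedIdeal.mem_mk' _ _ _ _ _ _ _).1 (hJ hx)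
  · intro hx
    induction hx using Submodule.span_induction with
    | mem y hy =>
      obtain ⟨q, hq, rfl⟩ := hy
      exact ofPath_mem_span_of_not_reduced hS hq
    | zero => exact zero_mem _
    | add y y' _ _ h h' => exact add_mem h h'
    | smul a y _ h => exact smul_mem_twoSidedIdeal _ a h

theorem ofPath_mem_span_iff {S : Set (QuiverPath V)} (hS : ∀ s ∈ S, s.2.2.length = 2)
    {q : QuiverPath V} : ofPath k q ∈ TwoSidedIdeal.span (ofPath k '' S) ↔ ¬ Reduced S q := by
  rw [mem_span_iff hS, ← mem_monomialSubmodule, ofPath_mem_monomialSubmodule]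

end Monomial

/-! ### The matrix representation attached to a path -/

section MatrixRepresentation

open Classical in
variable (k) in
/-- The matrix of a path `q`: the indicator matrix of its occurrences in `p`. -/
noncomputable def occurrenceMatrix (p : QuiverPath V) (m : ℕ) (q : QuiverPath V) :
    Matrix (Fin (m + 1)) (Fin (m + 1)) k :=
  Matrix.of fun i j => if Occurs p q i j then 1 else 0

variable (k) in
/-- The linear extension of `occurrenceMatrix`. -/
noncomputable def toMatrixLinear (p : QuiverPath V) (m : ℕ) :
    PathAlgebra k V →ₗ[k] Matrix (Fin (m + 1)) (Fin (m + 1)) k :=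
  (basis k V).constr k (occurrenceMatrix k p m)

theorem toMatrixLinear_ofPath (p : QuiverPath V) (m : ℕ) (q : QuiverPath V) :
    toMatrixLinear k p m (ofPath k q) = occurrenceMatrix k p m q := by
  rw [toMatrixLinear, ← basis_apply, Module.Basis.constr_basis]

omit [Fintype V] [DecidableEq V] in
theorem occurrenceMatrix_of_occurs {p q : QuiverPath V} {m : ℕ} {i j : Fin (m + 1)}
    (h : Occurs p q i j) : occurrenceMatrix k p m q i j = 1 := if_pos h

omit [Fintype V] [DecidableEq V] in
theorem occurrenceMatrix_of_not_occurs {p q : QuiverPath V} {m : ℕ} {i j : Fin (m + 1)}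
    (h : ¬ Occurs p q i j) : occurrenceMatrix k p m q i j = 0 := if_neg h

variable {p : QuiverPath V} {m : ℕ} (hp : p.2.2.length = m)
include hp

omit [DecidableEq V] in
theorem sum_occurrenceMatrix_nil :
    ∑ x : V, occurrenceMatrix k p m ⟨x, x, Path.nil⟩ = 1 := by
  classical
  ext i j
  rw [Matrix.sum_apply]
  have hi : (i : ℕ) < p.2.2.vertices.length := by
    rw [Path.vertices_length, hp]; exact i.2
  by_cases hij : i = j
  · subst hij
    rw [Matrix.one_apply_eq, Finset.sum_eq_single p.2.2.vertices[(i : ℕ)]]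
    · exact occurrenceMatrix_of_occurs (Occurs.nil_iff.2 ⟨rfl, List.getElem?_eq_getElem hi⟩)
    · intro x _ hx
      refine occurrenceMatrix_of_not_occurs fun h => hx ?_
      have := (Occurs.nil_iff.1 h).2
      rw [List.getElem?_eq_getElem hi] at this
      exact (Option.some.inj this).symm
    · simp
  · rw [Matrix.one_apply_ne hij]
    exact Finset.sum_eq_zero fun x _ => occurrenceMatrix_of_not_occurs fun h =>
      hij (Fin.ext (Occurs.nil_iff.1 h).1)

/-- An occurrence of `q r` between `i` and `l` splits at the one position `i + q.length`, so the sum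
in the matrix product has at most one nonzero term. -/
theorem toMatrixLinear_mulPath (q r : QuiverPath V) :
    toMatrixLinear k p m (mulPath k q r) = occurrenceMatrix k p m q * occurrenceMatrix k p m r := by
  ext i l
  rw [Matrix.mul_apply]
  obtain ⟨x, y, q⟩ := q
  obtain ⟨y', z, r⟩ := r
  by_cases h : y' = y
  · subst h
    rw [mulPath_of_eq, toMatrixLinear_ofPath]
    by_cases ho : Occurs p ⟨x, z, q.comp r⟩ i l
    · have h2 := ho.of_comp
      have hj : i + q.length < m + 1 := by
        have := h2.1.le_length
        lia
      rw [occurrenceMatrix_of_occurs ho, Finset.sum_eq_single ⟨i + q.length, hj⟩]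
      · rw [occurrenceMatrix_of_occurs h2.1, occurrenceMatrix_of_occurs h2.2, one_mul]
      · intro j _ hne
        rw [occurrenceMatrix_of_not_occurs, zero_mul]
        exact fun h => hne (Fin.ext h.add_length.symm)
      · simp
    · rw [occurrenceMatrix_of_not_occurs ho, Finset.sum_eq_zero]
      intro j _
      by_cases h1 : Occurs p ⟨x, y', q⟩ i j
      · rw [occurrenceMatrix_of_not_occurs (q := ⟨y', z, r⟩) fun h2 => ho (h1.comp h2), mul_zero]
      · rw [occurrenceMatrix_of_not_occurs h1, zero_mul]
  · rw [mulPath_of_ne h, map_zero, Matrix.zero_apply, Finset.sum_eq_zero]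
    intro j _
    by_cases h1 : Occurs p ⟨x, y, q⟩ i j
    · rw [occurrenceMatrix_of_not_occurs (q := ⟨y', z, r⟩) fun h2 => h (h1.end_eq h2), mul_zero]
    · rw [occurrenceMatrix_of_not_occurs h1, zero_mul]

theorem toMatrixLinear_mul (x y : PathAlgebra k V) :
    toMatrixLinear k p m (x * y) = toMatrixLinear k p m x * toMatrixLinear k p m y := by
  induction x using induction with
  | zero => rw [zero_mul, map_zero, zero_mul]
  | add x x' h h' => rw [add_mul, map_add, map_add, add_mul, h, h']
  | smul a x h => rw [smul_mul_assoc, map_smul, map_smul, smul_mul_assoc, h]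
  | path q =>
    induction y using induction with
    | zero => rw [mul_zero, map_zero, mul_zero]
    | add x x' h h' => rw [mul_add, map_add, map_add, mul_add, h, h']
    | smul a x h => rw [mul_smul_comm, map_smul, map_smul, mul_smul_comm, h]
    | path r =>
      rw [ofPath_mul_ofPath, toMatrixLinear_mulPath hp, toMatrixLinear_ofPath,
        toMatrixLinear_ofPath]

variable (k) in
/-- The representation of the path algebra by row vectors that is attached to a path `p` of length
`m`. -/
noncomputable def toMatrix : PathAlgebra k V →ₐ[k] Matrix (Fin (m + 1)) (Fin (m + 1)) k :=
  AlgHom.ofLinearMap (toMatrixLinear k p m)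
    (by rw [one_def, map_sum, ← sum_occurrenceMatrix_nil hp]
        exact Finset.sum_congr rfl fun x _ => toMatrixLinear_ofPath p m _)
    (toMatrixLinear_mul hp)

theorem toMatrix_ofPath (q : QuiverPath V) :
    toMatrix k hp (ofPath k q) = occurrenceMatrix k p m q := toMatrixLinear_ofPath p m q

/-- Only one path occurs in `p` between two given positions, so each entry of the matrix is a single
coefficient of `x`. -/
theorem toMatrix_apply_of_occurs (x : PathAlgebra k V) {q : QuiverPath V} {i j : Fin (m + 1)}
    (h : Occurs p q i j) : toMatrix k hp x i j = (basis k V).repr x q := by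
  induction x using induction with
  | zero => simp
  | add x x' h h' => rw [map_add, Matrix.add_apply, h, h', map_add, Finsupp.add_apply]
  | smul a x h => rw [map_smul, Matrix.smul_apply, h, map_smul, Finsupp.smul_apply]
  | path r =>
    rw [toMatrix_ofPath, ← basis_apply, Module.Basis.repr_self]
    by_cases hr : r = q
    · subst hr
      rw [occurrenceMatrix_of_occurs h, Finsupp.single_eq_same]
    · rw [occurrenceMatrix_of_not_occurs fun h' => hr (h'.eq h), Finsupp.single_eq_of_ne (Ne.symm hr)]

theorem toMatrix_apply_of_lt (x : PathAlgebra k V) {i j : Fin (m + 1)} (h : j < i) :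
    toMatrix k hp x i j = 0 := by
  induction x using induction with
  | zero => simp
  | add x x' h h' => rw [map_add, Matrix.add_apply, h, h', add_zero]
  | smul a x h => rw [map_smul, Matrix.smul_apply, h, smul_zero]
  | path r =>
    rw [toMatrix_ofPath]
    exact occurrenceMatrix_of_not_occurs fun h' => not_lt_of_ge h'.le h

theorem toMatrix_eq_zero_iff {x : PathAlgebra k V} :
    toMatrix k hp x = 0 ↔ ∀ q i j, Occurs p q i j → (basis k V).repr x q = 0 := by
  constructor
  · intro h q i j hq
    have hj := hq.le_length
    have hi := hq.le
    rw [← toMatrix_apply_of_occurs hp x (i := ⟨i, by lia⟩) (j := ⟨j, by lia⟩) hq, h,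
      Matrix.zero_apply]
  · intro h
    ext i j
    rcases lt_or_ge j i with hij | hij
    · rw [toMatrix_apply_of_lt hp x hij, Matrix.zero_apply]
    · obtain ⟨q, hq⟩ := Occurs.exists_of_le p (i := i) (j := j) hij (by lia)
      rw [toMatrix_apply_of_occurs hp x hq, h q i j hq, Matrix.zero_apply]

end MatrixRepresentation

end PathAlgebra

end

section

open Quiver QuiverPath PathAlgebra

/-! ### Gentle algebras with one maximal path are matrix algebras -/

namespace IsGentle

variable {k : Type u} {V : Type v} [Field k] [Quiver.{w} V] [Fintype V] [DecidableEq V]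
  {S : Set (QuiverPath V)} (hS : ∀ s ∈ S, s.2.2.length = 2)
  (hI : IsGentle (TwoSidedIdeal.span (ofPath k '' S)))

include hS hI

/-- The reduced paths are linearly independent modulo the ideal, and the quotient is
finite-dimensional. -/
theorem finite_setOf_reduced : {q | Reduced S q}.Finite := by
  have := hI.finiteDimensional
  let π := RingCon.mkₐ k (TwoSidedIdeal.span (ofPath k '' S)).ringCon
  have hli : LinearIndependent k fun q : {q | Reduced S q} => π (ofPath k q.1) := by
    rw [linearIndependent_iff]
    intro l hl
    have h1 : π (Finsupp.linearCombination k (fun q : {q | Reduced S q} => ofPath k q.1) l) = 0 := by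
      rw [← hl]
      exact Finsupp.apply_linearCombination k π.toLinearMap _ l
    have h2 : Finsupp.linearCombination k (fun q : {q | Reduced S q} => ofPath k q.1) l ∈
        TwoSidedIdeal.span (ofPath k '' S) := (RingCon.eq _).1 h1
    ext q
    have h3 := (mem_span_iff hS).1 h2 q.1 q.2
    have h4 : Finsupp.linearCombination k (fun q : {q | Reduced S q} => ofPath k q.1) l =
        (basis k V).repr.symm (l.mapDomain Subtype.val) := by
      rw [Module.Basis.repr_symm_apply, Finsupp.linearCombination_mapDomain]
      rfl
    rw [h4, LinearEquiv.apply_symm_apply, Finsupp.mapDomain_apply Subtype.val_injective] at h3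
    exact h3
  have := hli.finite_of_isNoetherian
  exact Set.toFinite _

variable {p : QuiverPath V}
  (hmax : ∀ q, IsMaximalPath (TwoSidedIdeal.span (ofPath k '' S)) q ↔ q = p)
include hmax

omit hI in
theorem reduced_maximalPath : Reduced S p := by
  have := ((hmax p).2 rfl).1
  rwa [ofPath_mem_span_iff hS, not_not] at this

/-- Every reduced path occurs in the maximal path. -/
theorem exists_occurs {q : QuiverPath V} (hq : Reduced S q) : ∃ i j, Occurs p q i j := by
  -- A longest reduced path that contains `q` cannot be extended by an arrow at either end, so it is
  -- a maximal path and equals `p`.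
  let C : Set (QuiverPath V) := {r | Reduced S r ∧ ∃ i j, Occurs r q i j}
  have hC : C.Finite := (finite_setOf_reduced hS hI).subset fun r hr => hr.1
  obtain ⟨r, hr, hrmax⟩ := Set.exists_max_image C (fun r => r.2.2.length) hC
    ⟨q, hq, 0, _, Path.nil, Path.nil, by simp, rfl, rfl⟩
  have hrp : r = p := by
    refine (hmax r).1 ⟨?_, fun z a => ?_, fun z a => ?_⟩
    · rw [ofPath_mem_span_iff hS, not_not]
      exact hr.1
    · rw [ofPath_mem_span_iff hS]
      intro h
      obtain ⟨i, j, b, c, hbc, -, -⟩ := hr.2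
      have := hrmax ⟨r.1, z, r.2.2.comp a.toPath⟩
        ⟨h, _, _, b, c.comp a.toPath, by rw [hbc]; simp, rfl, rfl⟩
      simp at this
    · rw [ofPath_mem_span_iff hS]
      intro h
      obtain ⟨i, j, b, c, hbc, -, -⟩ := hr.2
      have := hrmax ⟨z, r.2.1, a.toPath.comp r.2.2⟩
        ⟨h, _, _, a.toPath.comp b, c, by rw [hbc]; simp, rfl, rfl⟩
      simp at this
  exact hrp ▸ hr.2

omit hmax in
theorem arrow_eq_of_reduced {x y z z' : V} {f : x ⟶ y} {e : y ⟶ z} {e' : y ⟶ z'}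
    (h : Reduced S ⟨x, z, f.toPath.comp e.toPath⟩)
    (h' : Reduced S ⟨x, z', f.toPath.comp e'.toPath⟩) :
    (⟨z, e⟩ : Σ z : V, (y ⟶ z)) = ⟨z', e'⟩ := by
  refine hI.right_notMem f ?_ ?_
  · exact fun hmem => (ofPath_mem_span_iff hS).1 hmem h
  · exact fun hmem => (ofPath_mem_span_iff hS).1 hmem h'

/-- By gentleness the last arrow of `q` has at most one nonzero continuation, so the same arrow
follows both occurrences and `q` can be prolonged. Eventually the later occurrence reaches the end
of `p`, while the earlier one is still followed by an arrow `e`; then `p e` is nonzero, against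
maximality. -/
theorem not_two_occurrences (n : ℕ) {x y : V} (q : Path x y) (hq : q.length ≠ 0)
    {a a' : Path p.1 x} {b b' : Path y p.2.1} (h : p.2.2 = a.comp (q.comp b))
    (h' : p.2.2 = a'.comp (q.comp b')) (hlt : a.length < a'.length) (hn : b'.length = n) :
    False := by
  have hred := reduced_maximalPath hS hmax
  induction n using Nat.strong_induction_on generalizing x y with
  | _ n ih =>
  have hlen : b.length ≠ 0 := by
    have := congrArg Path.length (h.symm.trans h')
    simp only [Path.length_comp] at this
    lia
  obtain ⟨z, e, b, rfl, -⟩ := (Path.length_ne_zero_iff_eq_comp b).1 hlen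
  have hqe : Reduced S ⟨x, z, q.comp e.toPath⟩ :=
    hred.of_infix ⟨a.arrows, b.arrows, by rw [h]; simp⟩
  by_cases hb' : b'.length = 0
  · obtain ⟨s, t, p⟩ := p
    dsimp only at *
    obtain rfl := Path.eq_of_length_zero b' hb'
    obtain rfl := Path.eq_nil_of_length_zero b' hb'
    refine (ofPath_mem_span_iff hS).1 (((hmax _).2 rfl).2.1 z e) ?_
    change List.IsChain _ (p.comp e.toPath).arrows
    rw [h', Path.comp_nil, Path.arrows_comp, Path.arrows_comp]
    -- Now `p` ends in `q`. As relations have length two and `q` is nonempty, `p e` is reduced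
    -- because `p` and `q e` are.
    refine List.IsChain.append_overlap ?_ ?_ fun hnil => hq ?_
    · have : List.IsChain _ p.arrows := hred
      rwa [h', Path.comp_nil, Path.arrows_comp] at this
    · have : List.IsChain _ (q.comp e.toPath).arrows := hqe
      rwa [Path.arrows_comp] at this
    · rw [← Path.length_arrows, hnil, List.length_nil]
  · obtain ⟨z', e', b', rfl, -⟩ := (Path.length_ne_zero_iff_eq_comp b').1 hb'
    obtain ⟨y', q', f, hq'⟩ := (Path.length_ne_zero_iff_eq_cons q).1 hq
    have h1 : Reduced S ⟨y', z, f.toPath.comp e.toPath⟩ :=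
      hqe.of_infix ⟨q'.arrows, [], by simp [hq']⟩
    have h2 : Reduced S ⟨y', z', f.toPath.comp e'.toPath⟩ :=
      hred.of_infix ⟨a'.arrows ++ q'.arrows, b'.arrows, by rw [h', hq']; simp⟩
    obtain ⟨rfl, he⟩ := Sigma.mk.inj (arrow_eq_of_reduced hS hI h1 h2)
    obtain rfl := eq_of_heq he
    exact ih b'.length (by rw [← hn, Path.length_comp, Path.length_toPath]; lia) (q.comp e.toPath)
      (by simp) (b := b) (b' := b') (by rw [h, Path.comp_assoc]) (by rw [h', Path.comp_assoc]) hlt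
      rfl

/-- A path of positive length occurs at most once in the maximal path. -/
theorem occurs_unique {q : QuiverPath V} (hq : q.2.2.length ≠ 0) {i j i' j' : ℕ}
    (h : Occurs p q i j) (h' : Occurs p q i' j') : i = i' ∧ j = j' := by
  have hi : i = i' := by
    obtain ⟨a, b, h, rfl, -⟩ := h
    obtain ⟨a', b', h', rfl, -⟩ := h'
    rcases lt_trichotomy a.length a'.length with hlt | heq | hlt
    · exact (not_two_occurrences hS hI hmax _ _ hq h h' hlt rfl).elim
    · exact heq
    · exact (not_two_occurrences hS hI hmax _ _ hq h' h hlt rfl).elim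
  exact ⟨hi, by rw [← h.add_length, ← h'.add_length, hi]⟩

variable {m : ℕ} (hp : p.2.2.length = m)

theorem mem_iff_toMatrix_eq_zero {x : PathAlgebra k V} :
    x ∈ TwoSidedIdeal.span (ofPath k '' S) ↔ toMatrix k hp x = 0 := by
  rw [mem_span_iff hS, toMatrix_eq_zero_iff hp]
  constructor
  · exact fun h q i j hq => h q ((reduced_maximalPath hS hmax).of_occurs hq)
  · intro h q hq
    obtain ⟨i, j, hij⟩ := exists_occurs hS hI hmax hq
    exact h q i j hij

variable {α : Equiv.Perm (Fin (m + 1))}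
  (hα : ∀ i j : Fin (m + 1),
    p.2.2.vertices[(i : ℕ)]? = p.2.2.vertices[(j : ℕ)]? ↔ j = i ∨ j = α i)
include hα

omit hS hI hmax in
theorem toMatrix_mem (x : PathAlgebra k V) : toMatrix k hp x ∈ gentleMatrices α k := by
  refine ⟨fun i j h => toMatrix_apply_of_lt hp x h, fun i => ?_⟩
  obtain ⟨y, hy⟩ : ∃ y, p.2.2.vertices[(i : ℕ)]? = some y :=
    ⟨_, List.getElem?_eq_getElem (by rw [Path.vertices_length, hp]; exact i.2)⟩
  rw [toMatrix_apply_of_occurs hp x (Occurs.nil_iff.2 ⟨rfl, hy⟩), toMatrix_apply_of_occurs hp x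
    (Occurs.nil_iff.2 ⟨rfl, (((hα i (α i)).2 (Or.inr rfl)).symm.trans hy)⟩)]

theorem exists_toMatrix_eq {T : Matrix (Fin (m + 1)) (Fin (m + 1)) k}
    (hT : T ∈ gentleMatrices α k) : ∃ x, toMatrix k hp x = T := by
  classical
  -- The coefficient of `q` is the entry of `T` at any occurrence of `q`. The choice is immaterial:
  -- a path of positive length occurs once, and a trivial path occurs at diagonal positions `i` and
  -- `α i`, where `T` agrees.
  let c : QuiverPath V → k := fun q =>
    if h : ∃ ij : Fin (m + 1) × Fin (m + 1), Occurs p q ij.1 ij.2 then T h.choose.1 h.choose.2 else 0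
  have hc : ∀ q (i j : Fin (m + 1)), Occurs p q i j → c q = T i j := by
    intro q i j hq
    have hex : ∃ ij : Fin (m + 1) × Fin (m + 1), Occurs p q ij.1 ij.2 := ⟨(i, j), hq⟩
    rw [show c q = T hex.choose.1 hex.choose.2 from dif_pos hex]
    have hq' : Occurs p q hex.choose.1 hex.choose.2 := hex.choose_spec
    generalize hex.choose.1 = i', hex.choose.2 = j' at hq'
    by_cases hl : q.2.2.length = 0
    · obtain ⟨x, y, q⟩ := q
      obtain rfl := Path.eq_of_length_zero q hl
      obtain rfl := Path.eq_nil_of_length_zero q hl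
      obtain ⟨h1, h2⟩ := Occurs.nil_iff.1 hq
      obtain ⟨h1', h2'⟩ := Occurs.nil_iff.1 hq'
      obtain rfl := Fin.ext h1
      obtain rfl := Fin.ext h1'
      rcases (hα i i').1 (h2.trans h2'.symm) with rfl | rfl
      · rfl
      · exact hT.2 i
    · obtain ⟨h1, h2⟩ := occurs_unique hS hI hmax hl hq hq'
      rw [Fin.ext h1, Fin.ext h2]
  refine ⟨(basis k V).repr.symm (Finsupp.onFinset (finite_setOf_reduced hS hI).toFinset c ?_), ?_⟩
  · intro q hq
    have hex : ∃ ij : Fin (m + 1) × Fin (m + 1), Occurs p q ij.1 ij.2 := by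
      by_contra h
      exact hq (dif_neg h)
    obtain ⟨ij, hij⟩ := hex
    exact (Set.Finite.mem_toFinset _).2 ((reduced_maximalPath hS hmax).of_occurs hij)
  ext i j
  rcases lt_or_ge j i with hij | hij
  · rw [toMatrix_apply_of_lt hp _ hij]
    exact (hT.1 hij).symm
  · obtain ⟨q, hq⟩ := Occurs.exists_of_le p (i := i) (j := j) hij (by lia)
    rw [toMatrix_apply_of_occurs hp _ hq, LinearEquiv.apply_symm_apply, Finsupp.onFinset_apply,
      hc q i j hq]

include hp

/-- The gentle algebra associated with `α` is isomorphic to the algebra of matrices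
`gentleMatrices α k`. -/
theorem nonempty_ringEquiv :
    Nonempty (BoundQuiverAlgebra (TwoSidedIdeal.span (ofPath k '' S)) ≃+* gentleMatrices α k) := by
  let f : PathAlgebra k V →+* gentleMatrices α k :=
    ((toMatrix k hp).codRestrict _ (toMatrix_mem hp hα)).toRingHom
  have hf : (TwoSidedIdeal.span (ofPath k '' S)).ringCon = RingCon.ker f := by
    ext x y
    rw [TwoSidedIdeal.rel_iff, mem_iff_toMatrix_eq_zero hS hI hmax hp, map_sub, sub_eq_zero,
      RingCon.ker_apply]
    exact (Subtype.ext_iff (a1 := f x) (a2 := f y)).symm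
  have hsurj : Function.Surjective f := fun T => by
    obtain ⟨x, hx⟩ := exists_toMatrix_eq hS hI hmax hp hα T.2
    exact ⟨x, Subtype.ext hx⟩
  change Nonempty (RingCon.Quotient _ ≃+* _)
  rw [hf]
  exact ⟨RingCon.quotientKerEquivOfSurjective f hsurj⟩

end IsGentle

/-- The gentle algebra associated with `α` is isomorphic to the algebra of matrices
`gentleMatrices α k`. -/
theorem IsGentleAssociatedTo.nonempty_ringEquiv {k : Type u} {V : Type v} [Field k] [Quiver.{w} V]
    [Fintype V] [DecidableEq V] {I : TwoSidedIdeal (PathAlgebra k V)} {m : ℕ}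
    {α : Equiv.Perm (Fin (m + 1))} (h : IsGentleAssociatedTo I α) :
    Nonempty (BoundQuiverAlgebra I ≃+* gentleMatrices α k) := by
  obtain ⟨hI, p, hmax, hp, hα⟩ := h
  obtain ⟨S, hS, rfl⟩ := hI.generated
  exact IsGentle.nonempty_ringEquiv hS hI hmax hp hα

end

/-! ### Combinatorics of the step functions -/

namespace QuasiDiagram

variable {m : ℕ} {α : Equiv.Perm (Fin (m + 1))}

theorem gSteps_last : gSteps α (Fin.last m) = 0 := if_pos rfl

theorem isIsolated_apply_iff {i : Fin (m + 1)} : IsIsolated α (α i) ↔ IsIsolated α i :=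
  α.injective.eq_iff

/-- For a regular quasi-diagram the set that defines `gSteps` is nonempty. -/
theorem exists_pow_of_isRegular (hα : IsQuasiDiagram α) (hreg : IsRegular α) (i : Fin (m + 1)) :
    ∃ g, 0 < g ∧ (((α * zeta m) ^ g) i = Fin.last m ∨ IsIsolated α (((α * zeta m) ^ g) i)) := by
  have hα' : ∀ a, α (α a) = a := fun a => by
    rw [← Equiv.Perm.mul_apply, show α * α = 1 from hα]; rfl
  have hconj : α * (zeta m * α) * α⁻¹ = α * zeta m := by group
  obtain ⟨j, hj, hj'⟩ := hreg (α i)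
  have h2 : (α * zeta m).SameCycle i (α j) := by
    have hinv : α⁻¹ = α := inv_eq_of_mul_eq_one_left hα
    rwa [← hconj, Equiv.Perm.sameCycle_conj, hinv, hα']
  have h3 : ∃ l, (α * zeta m).SameCycle i l ∧ (l = Fin.last m ∨ IsIsolated α l) := by
    rcases hj' with rfl | hj'
    -- Conjugation by `α` turns the orbits of `ζα` into those of `αζ` and moves `0` to `α 0`, which
    -- is the image of the last point under `αζ`.
    · refine ⟨Fin.last m, h2.trans (Equiv.Perm.SameCycle.symm ⟨1, ?_⟩), Or.inl rfl⟩
      rw [zpow_one, Equiv.Perm.mul_apply, zeta, finRotate_last]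
    · exact ⟨α j, h2, Or.inr (isIsolated_apply_iff.2 hj')⟩
  obtain ⟨l, hl, hl'⟩ := h3
  obtain ⟨g, hg, -, rfl⟩ := hl.exists_pow_eq''
  exact ⟨g, hg, hl'⟩

theorem gSteps_le {i : Fin (m + 1)} (hi : i ≠ Fin.last m) {g : ℕ} (hg : 0 < g)
    (h : ((α * zeta m) ^ g) i = Fin.last m ∨ IsIsolated α (((α * zeta m) ^ g) i)) :
    gSteps α i ≤ g := by
  rw [gSteps, if_neg hi]
  exact Nat.sInf_le ⟨hg, h⟩

theorem gSteps_spec (hα : IsQuasiDiagram α) (hreg : IsRegular α) {i : Fin (m + 1)}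
    (hi : i ≠ Fin.last m) :
    0 < gSteps α i ∧ (((α * zeta m) ^ gSteps α i) i = Fin.last m ∨
      IsIsolated α (((α * zeta m) ^ gSteps α i) i)) := by
  rw [gSteps, if_neg hi]
  exact Nat.sInf_mem (exists_pow_of_isRegular hα hreg i)

theorem gSteps_of_isIsolated (hα : IsQuasiDiagram α) (hreg : IsRegular α) {i : Fin (m + 1)}
    (hi : i ≠ Fin.last m) (h : α (finRotate _ i) = finRotate _ i) : gSteps α i = 1 := by
  refine le_antisymm (gSteps_le hi one_pos (Or.inr ?_)) (gSteps_spec hα hreg hi).1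
  rw [pow_one, Equiv.Perm.mul_apply, IsIsolated, h, h]

theorem gSteps_step (hα : IsQuasiDiagram α) (hreg : IsRegular α) {i : Fin (m + 1)}
    (hi : i ≠ Fin.last m) (h : α (finRotate _ i) ≠ finRotate _ i) :
    gSteps α i = gSteps α (α (finRotate _ i)) + 1 := by
  set j := α (finRotate _ i) with hj
  have hpow : ∀ g, ((α * zeta m) ^ (g + 1)) i = ((α * zeta m) ^ g) j := fun g => by
    rw [pow_succ, Equiv.Perm.mul_apply]; rfl
  have hiso : ¬ IsIsolated α j := fun h' => h (isIsolated_apply_iff.1 h')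
  obtain ⟨hc, hc'⟩ := gSteps_spec hα hreg hi
  by_cases hjl : j = Fin.last m
  · rw [hjl, gSteps_last]
    exact le_antisymm (gSteps_le hi one_pos (Or.inl (by rw [← hjl, pow_one]; rfl))) hc
  · obtain ⟨hd, hd'⟩ := gSteps_spec hα hreg hjl
    refine le_antisymm (gSteps_le hi (Nat.succ_pos _) (by rwa [hpow])) ?_
    obtain ⟨c, hce⟩ := Nat.exists_eq_succ_of_ne_zero hc.ne'
    rw [hce, Nat.succ_eq_add_one, hpow] at hc'
    rw [hce, Nat.succ_eq_add_one, Nat.add_le_add_iff_right]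
    refine gSteps_le hjl (Nat.pos_of_ne_zero ?_) hc'
    rintro rfl
    exact hc'.elim hjl hiso

/-- The maximum of `gSteps` is attained at an isolated point or at `α 0`. -/
theorem exists_gSteps_max (hα : IsQuasiDiagram α) (hreg : IsRegular α) :
    ∃ j, (α j = j ∨ j = α 0) ∧ ∀ i, gSteps α i ≤ gSteps α j := by
  obtain ⟨j, -, hj⟩ := Finset.exists_max_image Finset.univ (gSteps α) Finset.univ_nonempty
  have hα' : ∀ a, α (α a) = a := fun a => by
    rw [← Equiv.Perm.mul_apply, show α * α = 1 from hα]; rfl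
  by_cases h : α j = j ∨ j = α 0
  · exact ⟨j, h, fun i => hj i (Finset.mem_univ i)⟩
  · push Not at h
    exfalso
    -- This is the predecessor of `j` under `αζ`. It is not the last point because `j ≠ α 0`, so
    -- `gSteps` is larger by one at `i` than at `j`, contradicting the choice of `j`.
    let i := (finRotate (m + 1)).symm (α j)
    have hi : finRotate (m + 1) i = α j := Equiv.apply_symm_apply _ _
    have hil : i ≠ Fin.last m := by
      intro hl
      rw [hl, finRotate_last] at hi
      exact h.2 (by rw [hi, hα'])
    have := gSteps_step hα hreg hil (by rw [hi, hα']; exact h.1.symm)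
    rw [hi, hα'] at this
    have := hj i (Finset.mem_univ i)
    lia

/-- Conjugation by `α` exchanges the two step functions. -/
theorem dSteps_eq_gSteps (hα : IsQuasiDiagram α) (i : Fin (m + 1)) :
    dSteps α i = gSteps α (α i) := by
  have hα' : ∀ a, α (α a) = a := fun a => by
    rw [← Equiv.Perm.mul_apply, show α * α = 1 from hα]; rfl
  have hpow : ∀ d, ((zeta m * α) ^ d) i = α (((α * zeta m) ^ d) (α i)) := by
    intro d
    induction d with
    | zero => simp [hα']
    | succ d ih =>
      rw [pow_succ', pow_succ', Equiv.Perm.mul_apply, ih]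
      simp [Equiv.Perm.mul_apply, hα']
  have hlast : ∀ a, α a = Fin.last m ↔ a = α (Fin.last m) := fun a =>
    ⟨fun h => by rw [← h, hα'], fun h => by rw [h, hα']⟩
  unfold dSteps gSteps
  simp only [hpow, hlast, isIsolated_apply_iff, α.injective.eq_iff]

end QuasiDiagram

-- Change of universe and conclusion

universe x

/-- An isomorphism of fields induces an isomorphism of the matrix algebras. -/
def gentleMatrices.congr {m : ℕ} (α : Equiv.Perm (Fin (m + 1))) {k : Type u} {K : Type v} [Field k]
    [Field K] (σ : k ≃+* K) : gentleMatrices α k ≃+* gentleMatrices α K where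
  toFun T := ⟨σ.mapMatrix T.1, fun _ _ h => (congrArg σ (T.2.1 h)).trans (map_zero σ),
    fun i => congrArg σ (T.2.2 i)⟩
  invFun T := ⟨σ.symm.mapMatrix T.1, fun _ _ h => (congrArg σ.symm (T.2.1 h)).trans (map_zero σ.symm),
    fun i => congrArg σ.symm (T.2.2 i)⟩
  left_inv T := Subtype.ext (σ.mapMatrix.symm_apply_apply T.1)
  right_inv T := Subtype.ext (σ.mapMatrix.apply_symm_apply T.1)
  map_mul' S T := Subtype.ext (map_mul σ.mapMatrix S.1 T.1)
  map_add' S T := Subtype.ext (map_add σ.mapMatrix S.1 T.1)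

/-- The base field of an algebra can be replaced by a field in the universe of the algebra. -/
theorem gentleMatrices.exists_ringEquiv {m : ℕ} {α : Equiv.Perm (Fin (m + 1))} {k : Type u}
    [Field k] {A : Type x} [Ring A] [Algebra k A] (e : A ≃+* gentleMatrices α k) :
    ∃ (K : Type x) (_ : Field K), Nonempty (A ≃+* gentleMatrices α K) := by
  have : Nontrivial A := e.toEquiv.nontrivial
  -- `globalDimension` ranges over modules in the universe of the ring, so `A` must be compared with
  -- matrices in its own universe. The field fits there because it embeds into the nonzero algebra
  -- `A`.
  have : Small.{x} k := small_of_injective (algebraMap k A).injective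
  exact ⟨Shrink.{x} k, inferInstance, ⟨e.trans (congr α (Shrink.ringEquiv.{x} k).symm)⟩⟩

theorem proposition3p5 {k : Type u} [Field k] [IsAlgClosed k] [CharZero k]
    {m : ℕ} (α : Equiv.Perm (Fin (m + 1)))
    (hα : QuasiDiagram.IsQuasiDiagram α) (hreg : QuasiDiagram.IsRegular α)
    {V : Type v} [Fintype V] [DecidableEq V] [Quiver.{w} V]
    (I : TwoSidedIdeal (PathAlgebra k V)) (hI : IsGentleAssociatedTo I α)
    {A : Type*} [Ring A] [Algebra k A] (hA : Nonempty (A ≃ₐ[k] BoundQuiverAlgebra I)) :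
    IsGreatest {x : WithBot ℕ∞ | ∃ j, (QuasiDiagram.IsIsolated α j ∨ j = α 0) ∧
        x = (QuasiDiagram.gSteps α j : ℕ)} (globalDimension A) ∧
    IsGreatest {x : WithBot ℕ∞ | ∃ i, (QuasiDiagram.IsIsolated α i ∨ i = 0) ∧
        x = (QuasiDiagram.dSteps α i : ℕ)} (globalDimension A) := by
  have hα' : ∀ a, α (α a) = a := fun a => by
    rw [← Equiv.Perm.mul_apply, show α * α = 1 from hα]; rfl
  obtain ⟨e₁⟩ := hA
  obtain ⟨e₂⟩ := hI.nonempty_ringEquiv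
  obtain ⟨K, _, ⟨e⟩⟩ := gentleMatrices.exists_ringEquiv (e₁.toRingEquiv.trans e₂)
  have hmain : IsGreatest {x : WithBot ℕ∞ | ∃ j, (QuasiDiagram.IsIsolated α j ∨ j = α 0) ∧
      x = (QuasiDiagram.gSteps α j : ℕ)} (globalDimension A) := by
    rw [globalDimension_eq_of_ringEquiv e]
    exact GentleMatrix.isGreatest_globalDimension hα QuasiDiagram.gSteps_last
      (fun i hi h => QuasiDiagram.gSteps_of_isIsolated hα hreg hi h)
      (fun i hi h => QuasiDiagram.gSteps_step hα hreg hi h)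
      (QuasiDiagram.exists_gSteps_max hα hreg)
  refine ⟨hmain, ?_⟩
  -- The involution `α` preserves isolated points and exchanges `0` with `α 0`, so it matches the
  -- two index sets.
  convert hmain using 1
  ext x
  constructor
  · rintro ⟨i, hi, rfl⟩
    refine ⟨α i, hi.imp QuasiDiagram.isIsolated_apply_iff.2 (fun h => by rw [h]), ?_⟩
    rw [QuasiDiagram.dSteps_eq_gSteps hα]
  · rintro ⟨j, hj, rfl⟩
    refine ⟨α j, hj.imp QuasiDiagram.isIsolated_apply_iff.2 (fun h => by rw [h, hα']), ?_⟩
    rw [QuasiDiagram.dSteps_eq_gSteps hα, hα']
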